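/- Consider a single-queue (non-idling) fork-join system with $k \ge 1$ parallel identical servers that is empty at time $0$. Job $n = 1,2,\dots$ arrives at time $A(n)$, where $0 \le A(1) \le A(2) \le \cdots$, and consists of $k$ tasks. The tasks wait in a single first-in first-out queue, ordered by job and, within a job, by task number $i \in \{1,\dots,k\}$; whenever a server is idle, it fetches the task at the head of the queue. Let $V_i(n)$ be the time at which task $i$ of job $n$ starts service and $Q_i(n)$ its service time. The waiting time of task $i$ of job $n$ is $W_i(n) = V_i(n) - A(n)$, the departure time of job $n$ is $D(n) = \max_{i} \{V_i(n) + Q_i(n)\}$ (jobs may depart out of order), and the sojourn time is $T(n) = D(n) - A(n)$. Assume that the service times $Q_i(n)$ are iid exponential with parameter $\mu > 0$ and independent of the arrival process. Let $0 < \theta < k\mu$ with $\theta \ne \mu$, and put $$\rho_Z(\theta) = \frac1\theta \ln\Bigl(\frac{k\mu}{k\mu-\theta}\Bigr), \qquad \beta = \frac{e^{\theta k \rho_Z(\theta)}-1}{e^{\theta\rho_Z(\theta)}-1}.$$ (a) General arrivals (G$|$M). Suppose that the arrival process is $(\sigma_A,\rho_A)$-lower constrained, i.e. $\mathsf{E}[e^{-\vartheta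 (A(n)-A(m))}] \le e^{-\vartheta(\rho_A(-\vartheta)(n-m)-\sigma_A(-\vartheta))}$ for all $n \ge m \ge 1$ and $\vartheta > 0$, and that $k\rho_Z(\theta) < \rho_A(-\theta)$. Let $$\alpha = \frac{e^{\theta\sigma_A(-\theta)}}{1-e^{-\theta(\rho_A(-\theta)-k\rho_Z(\theta))}}.$$ Then for all $n \ge 1$, $i \in \{1,\dots,k\}$ and $\tau \ge 0$, $$\mathsf{P}[T(n)>\tau] \le \alpha\beta\frac{\mu}{\mu-\theta}\bigl(e^{-\theta\tau}-e^{-\mu\tau}\bigr) + e^{-\mu\tau}, \qquad \mathsf{P}[W_i(n)>\tau] \le \alpha e^{\theta(i-1)\rho_Z(\theta)} e^{-\theta\tau}.$$ (b) Independent arrivals (GI$|$M). Suppose that the inter-arrival times $A(n+1)-A(n)$, $n \ge 1$, are iid, let $\rho_A(-\theta) = -\frac1\theta \ln \mathsf{E}[e^{-\theta(A(2)-A(1))}]$, and suppose that $k\rho_Z(\theta) \le \rho_A(-\theta)$. Then for all $n \ge 1$, $i \in \{1,\dots,k\}$ and $\tau \ge 0$, $$\mathsf{P}[T(n)>\tau]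 \le \beta\frac{\mu}{\mu-\theta}\bigl(e^{-\theta\tau}-e^{-\mu\tau}\bigr) + k e^{-\mu\tau}, \qquad \mathsf{P}[W_i(n)>\tau] \le e^{\theta(i-1)\rho_Z(\theta)} e^{-\theta\tau}.$$ -/

import Mathlib

open MeasureTheory ProbabilityTheory

/-! ### Sample paths of a single-queue fork-join system

Jobs are numbered `0, 1, 2, …` and the `k` tasks of a job are numbered by `Fin k`.
`a n` is the arrival time of job `n` and `q n i` is the service time of its task `i`.
The tasks wait in one first-in first-out queue, ordered by job and then by task number:
task `i` of job `n` has position `n * k + i` in the queue. -/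

namespace ForkJoin

/-- The server that becomes idle first, when server `j` becomes idle at time `f j`
(the one with the smallest number if there are several). -/
noncomputable def firstIdle {k : ℕ} [NeZero k] (f : Fin k → ℝ) : Fin k :=
  (Finset.univ.filter fun j => ∀ l, f j ≤ f l).min' <| by
    obtain ⟨j, hj⟩ := Finite.exists_min f
    exact ⟨j, by simpa using hj⟩

/-- `idleAt a q t j` is the time at which server `j` has finished all the work that was assigned
to it among the tasks at queue positions `0, …, t - 1`. All servers are idle initially. The task at
position `t` starts as soon as it has arrived and some server is idle, on the server that is idle
first. (When several servers are idle, the choice does not affect any start time, because the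
service time belongs to the task and the servers are identical.) -/
noncomputable def idleAt {k : ℕ} [NeZero k] (a : ℕ → ℝ) (q : ℕ → Fin k → ℝ) : ℕ → Fin k → ℝ
  | 0 => fun _ => 0
  | t + 1 =>
    let f := idleAt a q t
    Function.update f (firstIdle f)
      (max (a (t / k)) (f (firstIdle f)) + q (t / k) (Fin.ofNat k t))

/-- The time at which task `i` of job `n` starts service. -/
noncomputable def startTime {k : ℕ} [NeZero k] (a : ℕ → ℝ) (q : ℕ → Fin k → ℝ)
    (n : ℕ) (i : Fin k) : ℝ :=
  let f := idleAt a q (n * k + i)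
  max (a n) (f (firstIdle f))

/-- The departure time of job `n`: all of its tasks have finished service. -/
noncomputable def departureTime {k : ℕ} [NeZero k] (a : ℕ → ℝ) (q : ℕ → Fin k → ℝ) (n : ℕ) : ℝ :=
  Finset.univ.sup' Finset.univ_nonempty fun i : Fin k => startTime a q n i + q n i

/-- The waiting time of task `i` of job `n`. -/
noncomputable def waitingTime {k : ℕ} [NeZero k] (a : ℕ → ℝ) (q : ℕ → Fin k → ℝ)
    (n : ℕ) (i : Fin k) : ℝ :=
  startTime a q n i - a n

/-- The sojourn time of job `n`. -/
noncomputable def sojournTime {k : ℕ} [NeZero k] (a : ℕ → ℝ) (q : ℕ → Fin k → ℝ) (n : ℕ) : ℝ :=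
  departureTime a q n - a n

/-! ### Parameters of the bounds -/

/-- The arrival process `A` is `(σ, ρ)`-lower constrained; the parameters `σ`, `ρ` are functions of
`-θ` for `θ > 0`. -/
def IsLowerConstrained {Ω : Type*} [MeasurableSpace Ω] (P : Measure Ω) (A : ℕ → Ω → ℝ)
    (σ ρ : ℝ → ℝ) : Prop :=
  ∀ m n : ℕ, m ≤ n → ∀ θ : ℝ, 0 < θ →
    ∫ ω, Real.exp (-θ * (A n ω - A m ω)) ∂P
      ≤ Real.exp (-θ * (ρ (-θ) * ((n : ℝ) - (m : ℝ)) - σ (-θ)))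

/-- The minimal rate parameter `ρ_A(-θ)` of arrivals with iid inter-arrival times. -/
noncomputable def giArrivalRho {Ω : Type*} [MeasurableSpace Ω] (P : Measure Ω) (A : ℕ → Ω → ℝ)
    (θ : ℝ) : ℝ :=
  -(1 / θ) * Real.log (∫ ω, Real.exp (-θ * (A 1 ω - A 0 ω)) ∂P)

/-- `ρ_Z(θ)`, for exponential random variables with parameter `k * μ`. -/
noncomputable def rhoZ (k : ℕ) (μ θ : ℝ) : ℝ :=
  (1 / θ) * Real.log (k * μ / (k * μ - θ))

/-- The factor `β`. -/
noncomputable def beta (k : ℕ) (μ θ : ℝ) : ℝ :=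
  (Real.exp (θ * k * rhoZ k μ θ) - 1) / (Real.exp (θ * rhoZ k μ θ) - 1)

/-- The factor `α` for general arrivals; `σ` and `ρ` are the values of the arrival parameters. -/
noncomputable def alpha (k : ℕ) (μ θ σ ρ : ℝ) : ℝ :=
  Real.exp (θ * σ) / (1 - Real.exp (-θ * (ρ - k * rhoZ k μ θ)))

end ForkJoin

/-!
# Tail bounds for the single-queue fork-join system

As long as all `k` servers are busy, lack of memory makes the times between successive starts of
tasks independent exponential variables of rate `k * μ`. A state with idle servers is dominated by
one in which these servers have further exponential work, where states are compared by the order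
statistics of the times at which the servers become idle (`Dominated`). Serving a task preserves
this order, so the waiting time of the task at queue position `t` is stochastically at most that of
a single server of rate `k * μ` fed with the tasks one by one: `max 0 Yₜ` with
`Yₜ₊₁ = max 0 Yₜ + Zₜ - δₜ`, where `δₜ` is the time between the arrivals of the tasks (`waitLaw`,
`lintegral_serve_le`, `lintegral_residual_le`, `prob_delay_gt_le`).
Below, `c = kμ / (kμ - θ) = e^{θ ρ_Z(θ)}` is the exponential moment of `Zₜ`, and
`β = 1 + c + ⋯ + c ^ (k - 1)`.

*General arrivals.* Given the arrivals, the single server makes task `i` of job `n` wait longer than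
`u` only if, for some job `m ≤ n`, the sum of `(n - m) * k + i` exponential variables exceeds
`u + A n - A m` (`lintegral_waitLaw_dirac_le`). The Chernoff bound and the constraint on the
arrivals turn the sum over `m < n` into a geometric series, which is at most
`(α - 1) * c ^ i * e^{-θu}`. The term `m = n` does not involve the arrivals and is kept as an Erlang
tail (`prob_waitingTime_gt_le_of_lowerConstrained`).

*Independent arrivals.* The recursion preserves the bound `c ^ (t % k) * e^{-θu}` by the argument of
Kingman, since the increment of `Y` over one job has exponential moment at most one
(`waitLaw_gt_le`, `prob_waitingTime_gt_le_of_iid`).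

*Sojourn times.* The service time of a task is independent of its waiting time, so a tail bound
`e^{-θu}` for the waiting time becomes `h(τ) = μ / (μ - θ) * (e^{-θτ} - e^{-μτ})` plus a multiple of
`e^{-μτ}` (`prob_add_gt_le`), and the union bound over the tasks follows. For general arrivals the
multiple of `e^{-μτ}` has to be reduced to one. The union bound yields
`S * e^{-μτ} + (α - 1) * β * h(τ)`, where `S = ∑ i, (k / (k - 1)) ^ i ≤ 2 * k - 1` comes from
the Erlang tails, and the elementary inequality `min 1 (S * e^{-μτ}) ≤ β * h(τ) + e^{-μτ}`
(`min_sum_mul_exp_le`) together with the trivial bound by one gives the claim.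
-/

namespace ForkJoin

/-! ### An elementary inequality -/

/-- With `k = m + 1` servers, `(1 + 1 / m) ^ i` is the exponential moment `𝔼 exp (μ Γ)` of an Erlang
variable `Γ` with `i` stages of rate `k * μ`. -/
lemma sum_one_add_inv_pow_le (m : ℕ) (hm : 1 ≤ m) :
    ∑ i ∈ Finset.range (m + 1), (1 + 1 / (m : ℝ)) ^ i ≤ 2 * m + 1 := by
  have hm0 : (0 : ℝ) < m := by exact_mod_cast hm
  have hpow : (1 + 1 / (m : ℝ)) ^ (m + 1) ≤ 3 + 1 / m := by
    -- `(1 + 1 / m) ^ (m + 1) ≤ e * (1 + 1 / m)`, which is at most `3 + 1 / m` from `m = 7` on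
    by_cases h7 : m < 7
    · interval_cases m <;> norm_num
    · have h7' : (7 : ℝ) ≤ m := by exact_mod_cast not_lt.mp h7
      have h1 : (1 + 1 / (m : ℝ)) ^ m ≤ 2.7182818286 := by
        calc (1 + 1 / (m : ℝ)) ^ m ≤ (Real.exp (1 / m)) ^ m := by
              gcongr
              linarith [Real.add_one_le_exp (1 / (m : ℝ))]
          _ = Real.exp 1 := by
              rw [← Real.exp_nat_mul]
              congr 1
              field_simp
          _ ≤ 2.7182818286 := Real.exp_one_lt_d9.le
      have hi : 1 / (m : ℝ) ≤ 1 / 7 := by gcongr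
      have hi0 : 0 < 1 / (m : ℝ) := by positivity
      rw [pow_succ]
      nlinarith
  rw [geom_sum_eq (by simp; omega)]
  have : (1 + 1 / (m : ℝ) - 1) = 1 / m := by ring
  rw [this, div_div_eq_mul_div, div_one]
  calc ((1 + 1 / (m : ℝ)) ^ (m + 1) - 1) * m ≤ (3 + 1 / m - 1) * m := by gcongr
    _ = 2 * m + 1 := by field_simp; ring

/-- Truncation of the binomial series of `(1 - t)⁻ⁱ` after the cubic term. -/
lemma cubic_le_inv_pow {t : ℝ} (ht1 : t < 1) (i : ℕ) :
    1 + i * t + i * (i + 1) / 2 * t ^ 2 + i * (i + 1) * (i + 2) / 6 * t ^ 3 ≤ ((1 - t)⁻¹) ^ i := by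
  induction i with
  | zero => simp
  | succ i ih =>
    have h1 : 0 < 1 - t := by linarith
    rw [pow_succ ((1 - t)⁻¹), ← div_eq_mul_inv, le_div_iff₀ h1]
    refine le_trans ?_ ih
    have : 0 ≤ ((i : ℝ) + 1) * (i + 2) * (i + 3) / 6 * t ^ 4 := by positivity
    push_cast
    linarith

lemma sum_cubic (k : ℕ) (t : ℝ) :
    ∑ i ∈ Finset.range k,
      (1 + i * t + i * (i + 1) / 2 * t ^ 2 + i * (i + 1) * (i + 2) / 6 * t ^ 3) =
      k + k * (k - 1) / 2 * t + (k + 1) * k * (k - 1) / 6 * t ^ 2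
        + (k + 2) * (k + 1) * k * (k - 1) / 24 * t ^ 3 := by
  induction k with
  | zero => simp
  | succ k ih =>
    rw [Finset.sum_range_succ, ih]
    push_cast
    ring

lemma sum_pow_ge_cubic {k : ℕ} (hk : 1 ≤ k) {x : ℝ} (hx0 : 0 < x) (hxk : x < k) :
    1 + ((k : ℝ) - 1) * (1 + x / 2 + x ^ 2 / 6 + x ^ 3 / 24)
      ≤ ∑ i ∈ Finset.range k, ((k : ℝ) / (k - x)) ^ i := by
  have hk0 : (0 : ℝ) < k := by exact_mod_cast hk
  have hk1 : (1 : ℝ) ≤ k := by exact_mod_cast hk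
  have ht1 : x / k < 1 := by rwa [div_lt_one hk0]
  have hinv : (k : ℝ) / (k - x) = (1 - x / k)⁻¹ := by
    rw [one_sub_div hk0.ne', inv_div]
  rw [hinv]
  refine le_trans ?_ (Finset.sum_le_sum fun i _ => cubic_le_inv_pow ht1 i)
  rw [sum_cubic]
  have e : (k : ℝ) + k * (k - 1) / 2 * (x / k) + (k + 1) * k * (k - 1) / 6 * (x / k) ^ 2
        + (k + 2) * (k + 1) * k * (k - 1) / 24 * (x / k) ^ 3
      = 1 + ((k : ℝ) - 1) * (1 + x / 2 + x ^ 2 / 6 * (1 + 1 / k)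
        + x ^ 3 / 24 * (1 + 3 / k + 2 / k ^ 2)) := by
    field_simp
    ring
  rw [e]
  have hk1' : 0 ≤ (k : ℝ) - 1 := by linarith
  have a1 : 0 ≤ x ^ 2 / 6 * (1 / k) := by positivity
  have a2 : 0 ≤ x ^ 3 / 24 * (3 / k + 2 / k ^ 2) := by positivity
  gcongr 1 + _ * ?_
  linarith

lemma three_halves_le_log_five : (3 : ℝ) / 2 ≤ Real.log 5 := by
  rw [Real.le_log_iff_exp_le (by norm_num), ← pow_le_pow_iff_left₀ (Real.exp_pos _).le
    (by norm_num) two_ne_zero, ← Real.exp_nat_mul]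
  have : ((2 : ℕ) : ℝ) * (3 / 2) = ((3 : ℕ) : ℝ) * 1 := by norm_num
  rw [this, Real.exp_nat_mul]
  calc Real.exp 1 ^ 3 ≤ 2.7182818286 ^ 3 := by gcongr; exact Real.exp_one_lt_d9.le
    _ ≤ 5 ^ 2 := by norm_num

lemma two_mul_sub_one_div_add_one_le_log {p : ℝ} (hp : 1 ≤ p) :
    2 * (p - 1) / (p + 1) ≤ Real.log p := by
  have h0 : 0 < p + 1 := by linarith
  have h := Real.sum_range_le_log_div (x := (p - 1) / (p + 1))
    (div_nonneg (by linarith) h0.le) (by rw [div_lt_one h0]; linarith) 1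
  have e : (1 + (p - 1) / (p + 1)) / (1 - (p - 1) / (p + 1)) = p := by
    field_simp
    ring
  rw [e] at h
  norm_num at h
  linarith [mul_div_assoc 2 (p - 1) (p + 1)]

/-- For `1 < x` and at least three servers, the cubic lower bound for the geometric sum and
`p ≥ 5` suffice. -/
lemma two_le_cubic_mul {x p : ℝ} (hx : 1 < x) (hp : 5 ≤ p) :
    2 ≤ (1 + x / 2 + x ^ 2 / 6 + x ^ 3 / 24) * ((p ^ (1 - x) - 1) / (1 - x)) := by
  obtain ⟨s, hs, rfl⟩ : ∃ s : ℝ, 0 < s ∧ x = 1 + s := ⟨x - 1, by linarith, by ring⟩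
  have hD : 0 < 1 + 3 / 2 * s + 9 / 8 * s ^ 2 := by positivity
  have h5 : 1 + 3 / 2 * s + 9 / 8 * s ^ 2 ≤ p ^ s := by
    calc 1 + 3 / 2 * s + 9 / 8 * s ^ 2 = 1 + (3 / 2 * s) + (3 / 2 * s) ^ 2 / 2 := by ring
      _ ≤ Real.exp (3 / 2 * s) := Real.quadratic_le_exp_of_nonneg (by positivity)
      _ ≤ Real.exp (Real.log 5 * s) := by
          have := three_halves_le_log_five
          gcongr
      _ = 5 ^ s := by rw [Real.rpow_def_of_pos (by norm_num)]
      _ ≤ p ^ s := by gcongr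
  have hL : (3 / 2 + 9 / 8 * s) / (1 + 3 / 2 * s + 9 / 8 * s ^ 2)
      ≤ (p ^ (1 - (1 + s)) - 1) / (1 - (1 + s)) := by
    have e1 : (1 : ℝ) - (1 + s) = -s := by ring
    rw [e1, Real.rpow_neg (by linarith)]
    have h6 : (p ^ s)⁻¹ ≤ (1 + 3 / 2 * s + 9 / 8 * s ^ 2)⁻¹ := by gcongr
    rw [div_neg, ← neg_div, le_div_iff₀ hs]
    have : (3 / 2 + 9 / 8 * s) / (1 + 3 / 2 * s + 9 / 8 * s ^ 2) * s
        = 1 - (1 + 3 / 2 * s + 9 / 8 * s ^ 2)⁻¹ := by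
      field_simp
      ring
    linarith
  refine le_trans ?_ (mul_le_mul_of_nonneg_left hL (by positivity))
  rw [← mul_div_assoc, le_div_iff₀ hD]
  nlinarith [mul_nonneg hs.le (sq_nonneg (s - 1)), sq_nonneg (s - 1), pow_pos hs 3, pow_pos hs 4]

/-- The case `e ^ T = 2 * k - 1` of `min_exp_le_one_add_mul`. -/
lemma two_mul_sub_two_le_sum_mul {k : ℕ} (hk : 2 ≤ k) {x : ℝ} (hx0 : 0 < x) (hxk : x < k)
    (hx1 : x ≠ 1) :
    2 * (k : ℝ) - 2 ≤ (∑ i ∈ Finset.range k, ((k : ℝ) / (k - x)) ^ i)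
      * (((2 * k - 1 : ℝ) ^ (1 - x) - 1) / (1 - x)) := by
  have hk2 : (2 : ℝ) ≤ k := by exact_mod_cast hk
  set p : ℝ := 2 * k - 1 with hp
  have hp3 : 3 ≤ p := by linarith
  rcases lt_or_gt_of_ne hx1 with h | h
  -- for `x < 1` the sum is at least `k`, and `log p` bounds the second factor
  · have hb : (k : ℝ) ≤ ∑ i ∈ Finset.range k, ((k : ℝ) / (k - x)) ^ i := by
      calc (k : ℝ) = ∑ i ∈ Finset.range k, (1 : ℝ) := by simp
        _ ≤ _ := Finset.sum_le_sum fun i _ => one_le_pow₀ (by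
              rw [le_div_iff₀ (by linarith)]
              linarith)
    have hL : Real.log p ≤ (p ^ (1 - x) - 1) / (1 - x) := by
      rw [le_div_iff₀ (by linarith), Real.rpow_def_of_pos (by linarith)]
      linarith [Real.add_one_le_exp (Real.log p * (1 - x))]
    have hlog := two_mul_sub_one_div_add_one_le_log (p := p) (by linarith)
    have e : 2 * (k : ℝ) - 2 = k * (2 * (p - 1) / (p + 1)) := by
      have : p + 1 = 2 * k := by linarith
      rw [this, show p - 1 = 2 * k - 2 by linarith]
      field_simp
    rw [e]
    exact mul_le_mul hb (hlog.trans hL) (div_nonneg (by linarith) (by linarith)) (by linarith)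
  · have hb := sum_pow_ge_cubic (by omega : 1 ≤ k) hx0 hxk
    rcases hk.eq_or_lt with h2 | h3
    · subst h2
      have hx2 : x < 2 := by exact_mod_cast hxk
      -- The Bernoulli inequality at `1 / 3 = 1 - 2 / 3`
      have hL : (2 : ℝ) / 3 ≤ (p ^ (1 - x) - 1) / (1 - x) := by
        have e1 : p = 3 := by rw [hp]; norm_num
        have h1 := rpow_one_add_le_one_add_mul_self (s := -(2 / 3)) (by norm_num)
          (p := x - 1) (by linarith) (by linarith)
        have e2 : (3 : ℝ) ^ (1 - x) = (1 + -(2 / 3)) ^ (x - 1) := by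
          rw [show (1 : ℝ) + -(2 / 3) = 3⁻¹ by norm_num, Real.inv_rpow (by norm_num),
            ← Real.rpow_neg (by norm_num)]
          congr 1
          ring
        rw [e1, e2, le_div_iff_of_neg (by linarith)]
        linarith
      have hb3 : (3 : ℝ) ≤ ∑ i ∈ Finset.range 2, (((2 : ℕ) : ℝ) / ((2 : ℕ) - x)) ^ i := by
        have : (2 : ℝ) ≤ 2 / (2 - x) := by
          rw [le_div_iff₀ (by linarith)]
          linarith
        simp [Finset.sum_range_succ]
        linarith
      calc 2 * ((2 : ℕ) : ℝ) - 2 = 3 * (2 / 3) := by norm_num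
        _ ≤ _ := mul_le_mul hb3 hL (by norm_num) (by linarith)
    · have hk3 : (3 : ℝ) ≤ k := by exact_mod_cast h3
      have hL := two_le_cubic_mul h (p := p) (by linarith)
      have hL0 : 0 ≤ (p ^ (1 - x) - 1) / (1 - x) := by
        have : 0 < 1 + x / 2 + x ^ 2 / 6 + x ^ 3 / 24 := by positivity
        by_contra hneg
        nlinarith
      refine le_trans ?_ (mul_le_mul_of_nonneg_right hb hL0)
      nlinarith

/-- Slopes of the concave function `s ↦ (s ^ a - 1) / a`, `a < 1`, from the base point `1`. -/
lemma rpow_slope_concave {a s p : ℝ} (ha : a < 1) (ha0 : a ≠ 0) (hs : 1 ≤ s) (hsp : s ≤ p) :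
    (s - 1) * ((p ^ a - 1) / a) ≤ (p - 1) * ((s ^ a - 1) / a) := by
  have hd : ∀ u : ℝ, 0 < u → HasDerivAt (fun u : ℝ => (u ^ a - 1) / a) (u ^ (a - 1)) u := by
    intro u hu
    have h := ((Real.hasDerivAt_rpow_const (p := a) (Or.inl hu.ne')).sub_const 1).div_const a
    rwa [mul_div_cancel_left₀ _ ha0] at h
  have hc : ConcaveOn ℝ (Set.Ioi 0) fun u : ℝ => (u ^ a - 1) / a := by
    refine AntitoneOn.concaveOn_of_deriv (convex_Ioi 0)
      (fun u hu => (hd u hu).continuousAt.continuousWithinAt)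
      (fun u hu => (hd u (by simpa using hu)).differentiableAt.differentiableWithinAt) ?_
    intro u hu v hv huv
    rw [interior_Ioi] at hu hv
    rw [(hd u hu).deriv, (hd v hv).deriv]
    exact Real.rpow_le_rpow_of_nonpos hu huv (by linarith)
  rcases hs.eq_or_lt with rfl | hs1
  · simp
  · have hp1 : 0 < p - 1 := by linarith
    have h1mem : (1 : ℝ) ∈ Set.Ioi (0 : ℝ) := by simp
    have hpmem : p ∈ Set.Ioi (0 : ℝ) := Set.mem_Ioi.2 (by linarith)
    have hw1 : 0 ≤ (p - s) / (p - 1) := div_nonneg (by linarith) hp1.le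
    have hw2 : 0 ≤ (s - 1) / (p - 1) := div_nonneg (by linarith) hp1.le
    have := hc.2 h1mem hpmem hw1 hw2 (by field_simp; ring)
    have e : (p - s) / (p - 1) * 1 + (s - 1) / (p - 1) * p = s := by
      field_simp
      ring
    simp only [smul_eq_mul, Real.one_rpow, sub_self, zero_div, mul_zero, zero_add, e] at this
    calc (s - 1) * ((p ^ a - 1) / a) = (p - 1) * ((s - 1) / (p - 1) * ((p ^ a - 1) / a)) := by
          field_simp
      _ ≤ _ := by gcongr

/-- The inequality of `min_sum_mul_exp_le`, multiplied by `e ^ T`, with `x = θ / μ` and `T = μ τ`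
and with `2 * k - 1` as bound for the sum on the left. It follows from the corner
`e ^ T = 2 * k - 1` of the minimum, because the right-hand side is concave in `e ^ T` with value `1`
at `T = 0`, and increasing. -/
lemma min_exp_le_one_add_mul {k : ℕ} (hk : 2 ≤ k) {x : ℝ} (hx0 : 0 < x) (hxk : x < k)
    (hx1 : x ≠ 1) {T : ℝ} (hT : 0 ≤ T) :
    min (2 * (k : ℝ) - 1) (Real.exp T) ≤ 1 + (∑ i ∈ Finset.range k, ((k : ℝ) / (k - x)) ^ i)
      * ((Real.exp ((1 - x) * T) - 1) / (1 - x)) := by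
  have hk2 : (2 : ℝ) ≤ k := by exact_mod_cast hk
  have hb0 : 0 ≤ ∑ i ∈ Finset.range k, ((k : ℝ) / (k - x)) ^ i :=
    Finset.sum_nonneg fun i _ => pow_nonneg (div_nonneg (by linarith) (by linarith)) i
  have hkey := two_mul_sub_two_le_sum_mul hk hx0 hxk hx1
  set B := ∑ i ∈ Finset.range k, ((k : ℝ) / (k - x)) ^ i
  set p : ℝ := 2 * k - 1 with hp
  have hs1 : 1 ≤ Real.exp T := Real.one_le_exp hT
  rw [mul_comm (1 - x) T, Real.exp_mul]
  rcases le_total (Real.exp T) p with h | h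
  · rw [min_eq_right h]
    have := rpow_slope_concave (a := 1 - x) (by linarith) (sub_ne_zero.2 hx1.symm) hs1 h
    have hp1 : 0 < p - 1 := by linarith
    have : (p - 1) * (Real.exp T - 1) ≤ (p - 1) * (B * ((Real.exp T ^ (1 - x) - 1) / (1 - x))) := by
      calc (p - 1) * (Real.exp T - 1)
          ≤ B * ((p ^ (1 - x) - 1) / (1 - x)) * (Real.exp T - 1) := by
            gcongr
            · linarith
        _ = B * ((Real.exp T - 1) * ((p ^ (1 - x) - 1) / (1 - x))) := by ring
        _ ≤ B * ((p - 1) * ((Real.exp T ^ (1 - x) - 1) / (1 - x))) := by gcongr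
        _ = _ := by ring
    linarith [le_of_mul_le_mul_left this hp1]
  · rw [min_eq_left h]
    have : (p ^ (1 - x) - 1) / (1 - x) ≤ (Real.exp T ^ (1 - x) - 1) / (1 - x) := by
      have hp0 : 0 < p := by linarith
      rcases lt_or_gt_of_ne hx1 with h1 | h1
      · have : p ^ (1 - x) ≤ Real.exp T ^ (1 - x) := Real.rpow_le_rpow hp0.le h (by linarith)
        have : 0 < 1 - x := by linarith
        gcongr
      · have := Real.rpow_le_rpow_of_nonpos hp0 h (z := 1 - x) (by linarith)
        exact div_le_div_of_nonpos_of_le (by linarith) (by linarith)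
    nlinarith

lemma hypoexp_nonneg {μ θ τ : ℝ} (hμ : 0 < μ) (hθμ : θ ≠ μ) (hτ : 0 ≤ τ) :
    0 ≤ μ / (μ - θ) * (Real.exp (-θ * τ) - Real.exp (-μ * τ)) := by
  rcases lt_or_gt_of_ne hθμ with h | h
  · exact mul_nonneg (div_nonneg hμ.le (by linarith))
      (sub_nonneg.2 (Real.exp_le_exp.2 (by nlinarith)))
  · exact mul_nonneg_of_nonpos_of_nonpos (div_nonpos_of_nonneg_of_nonpos hμ.le (by linarith))
      (sub_nonpos.2 (Real.exp_le_exp.2 (by nlinarith)))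

/-- For a job that finds the queue empty, the union bound over its tasks gives `e^{-μτ}` with the
coefficient `∑ i, (kμ / (kμ - μ)) ^ i`, which is up to `2 * k - 1`. Capped at one, this is
nevertheless at most `e^{-μτ} + β h(τ)` with `h(τ) = μ / (μ - θ) (e^{-θτ} - e^{-μτ})`. -/
lemma min_sum_mul_exp_le {k : ℕ} (hk : 1 ≤ k) {μ θ τ : ℝ} (hμ : 0 < μ) (hθ : 0 < θ)
    (hθk : θ < k * μ) (hθμ : θ ≠ μ) (hτ : 0 ≤ τ) :
    min 1 ((∑ i ∈ Finset.range k, (k * μ / (k * μ - μ)) ^ i) * Real.exp (-μ * τ))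
      ≤ (∑ i ∈ Finset.range k, (k * μ / (k * μ - θ)) ^ i)
          * (μ / (μ - θ) * (Real.exp (-θ * τ) - Real.exp (-μ * τ))) + Real.exp (-μ * τ) := by
  have hsub : μ - θ ≠ 0 := sub_ne_zero.2 hθμ.symm
  have hx1 : θ / μ ≠ 1 := fun h => hθμ (by rwa [div_eq_one_iff_eq hμ.ne'] at h)
  have hh : μ / (μ - θ) * (Real.exp (-θ * τ) - Real.exp (-μ * τ))
      = Real.exp (-μ * τ) * ((Real.exp ((1 - θ / μ) * (μ * τ)) - 1) / (1 - θ / μ)) := by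
    have e1 : Real.exp (-θ * τ) = Real.exp (-μ * τ) * Real.exp ((1 - θ / μ) * (μ * τ)) := by
      rw [← Real.exp_add]
      congr 1
      field_simp
      ring
    rw [e1]
    have : 1 - θ / μ = (μ - θ) / μ := by field_simp
    rw [this]
    field_simp
  have hc : k * μ / (k * μ - θ) = (k : ℝ) / (k - θ / μ) := by
    rw [show (k : ℝ) - θ / μ = (k * μ - θ) / μ by field_simp, div_div_eq_mul_div]
  rcases hk.eq_or_lt with rfl | hk2
  · have h0 := hypoexp_nonneg hμ hθμ hτ
    simp only [Finset.range_one, Finset.sum_singleton, pow_zero, one_mul]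
    exact (min_le_right _ _).trans (by linarith)
  · have hkey := min_exp_le_one_add_mul hk2 (div_pos hθ hμ) ((div_lt_iff₀ hμ).2 hθk) hx1
      (mul_nonneg hμ.le hτ)
    obtain ⟨m, rfl⟩ : ∃ m, k = m + 1 := ⟨k - 1, by omega⟩
    have hm : 1 ≤ m := by omega
    have hm0 : (0 : ℝ) < m := by exact_mod_cast hm
    have hS := sum_one_add_inv_pow_le m hm
    have hd : ((m + 1 : ℕ) : ℝ) * μ / ((m + 1 : ℕ) * μ - μ) = 1 + 1 / (m : ℝ) := by
      push_cast
      rw [show ((m : ℝ) + 1) * μ - μ = m * μ by ring]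
      field_simp
    rw [hd, hh, hc]
    set E := Real.exp (-μ * τ)
    have hE : 0 < E := Real.exp_pos _
    have hinv : Real.exp (μ * τ) * E = 1 := by rw [← Real.exp_add]; simp
    calc min 1 ((∑ i ∈ Finset.range (m + 1), (1 + 1 / (m : ℝ)) ^ i) * E)
        ≤ min 1 ((2 * ((m + 1 : ℕ) : ℝ) - 1) * E) := by
          gcongr
          push_cast
          linarith
      _ = min (2 * ((m + 1 : ℕ) : ℝ) - 1) (Real.exp (μ * τ)) * E := by
          rw [min_mul_of_nonneg _ _ hE.le, hinv, min_comm]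
      _ ≤ _ := mul_le_mul_of_nonneg_right hkey hE.le
      _ = _ := by ring

end ForkJoin

namespace ForkJoin

variable {k : ℕ}

/-! ### Monotonicity of the queue in the idle times -/

/-- `f` is dominated by `f'` if, after a renumbering of the servers, every server becomes idle under
`f` no later than under `f'`; equivalently, the order statistics of `f` are at most those of
`f'`. -/
def Dominated (f f' : Fin k → ℝ) : Prop :=
  ∃ σ : Equiv.Perm (Fin k), ∀ j, f (σ j) ≤ f' j

lemma Dominated.of_le {f f' : Fin k → ℝ} (h : ∀ j, f j ≤ f' j) : Dominated f f' :=
  ⟨1, h⟩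

lemma Dominated.sub_const {f f' : Fin k → ℝ} (h : Dominated f f') (c : ℝ) :
    Dominated (fun j => f j - c) (fun j => f' j - c) := by
  obtain ⟨σ, hσ⟩ := h
  exact ⟨σ, fun j => by simpa using hσ j⟩

lemma Dominated.min_le_min {f f' : Fin k → ℝ} (h : Dominated f f') {i j : Fin k}
    (hi : ∀ l, f i ≤ f l) : f i ≤ f' j := by
  obtain ⟨σ, hσ⟩ := h
  exact (hi _).trans (hσ j)

/-- Domination survives when the first idle server of `f'` and any server of `f` are made busy. The
renumbering has to be changed so that it matches these two servers. -/
lemma Dominated.update {f f' : Fin k → ℝ} (h : Dominated f f') {i j : Fin k}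
    (hj : ∀ l, f' j ≤ f' l) {v v' : ℝ} (hv : v ≤ v') :
    Dominated (Function.update f i v) (Function.update f' j v') := by
  obtain ⟨σ, hσ⟩ := h
  refine ⟨Equiv.swap i (σ j) * σ, fun l => ?_⟩
  simp only [Equiv.Perm.coe_mul, Function.comp_apply]
  by_cases hl : l = j
  · subst hl
    simpa using hv
  · have hne : σ l ≠ σ j := fun h => hl (σ.injective h)
    rw [Function.update_of_ne hl]
    by_cases hli : σ l = i
    · have hne' : σ j ≠ i := fun h => hne (hli.trans h.symm)
      rw [hli, Equiv.swap_apply_left, Function.update_of_ne hne']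
      exact (hσ j).trans (hj l)
    · rw [Equiv.swap_apply_of_ne_of_ne hli hne, Function.update_of_ne hli]
      exact hσ l

variable [NeZero k]

lemma firstIdle_mem (f : Fin k → ℝ) :
    firstIdle f ∈ Finset.univ.filter fun j => ∀ l, f j ≤ f l :=
  Finset.min'_mem _ _

lemma firstIdle_le (f : Fin k → ℝ) (l : Fin k) : f (firstIdle f) ≤ f l :=
  (Finset.mem_filter.1 (firstIdle_mem f)).2 l

lemma firstIdle_eq_iff (f : Fin k → ℝ) (j : Fin k) :
    firstIdle f = j ↔ (∀ l, f j ≤ f l) ∧ ∀ l < j, ∃ m, f m < f l := by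
  constructor
  · rintro rfl
    refine ⟨firstIdle_le f, fun l hl => ?_⟩
    by_contra! h
    exact absurd (Finset.min'_le _ l (by simpa using h)) (not_le.2 hl)
  · rintro ⟨h1, h2⟩
    refine le_antisymm (Finset.min'_le _ j (by simpa using h1)) (not_lt.1 fun hlt => ?_)
    obtain ⟨m, hm⟩ := h2 _ hlt
    exact absurd (firstIdle_le f m) (not_le.2 hm)

/-- The idle times after a task with service time `q` that is present at time `0` has been
assigned. -/
noncomputable def serve (f : Fin k → ℝ) (q : ℝ) : Fin k → ℝ :=
  Function.update f (firstIdle f) (max 0 (f (firstIdle f)) + q)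

/-- The time that a task arriving at time `0` waits for an idle server. -/
noncomputable def delay (f : Fin k → ℝ) : ℝ :=
  max 0 (f (firstIdle f))

lemma Dominated.delay_le {f f' : Fin k → ℝ} (h : Dominated f f') : delay f ≤ delay f' :=
  max_le_max_left _ (h.min_le_min (firstIdle_le f))

lemma Dominated.serve {f f' : Fin k → ℝ} (h : Dominated f f') (q : ℝ) :
    Dominated (serve f q) (serve f' q) :=
  h.update (firstIdle_le f') (by gcongr; exact h.min_le_min (firstIdle_le f))

/-- Idle times of the servers measured from the arrival of the next task, when all servers are idle
initially; `δ t` is the time between the arrivals of the tasks at positions `t` and `t + 1`. -/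
noncomputable def residual (δ q : ℕ → ℝ) : ℕ → Fin k → ℝ
  | 0 => 0
  | t + 1 => fun j => serve (residual δ q t) (q t) j - δ t

lemma residual_congr {δ δ' q q' : ℕ → ℝ} {t : ℕ} (hδ : ∀ s < t, δ s = δ' s)
    (hq : ∀ s < t, q s = q' s) :
    (residual δ q t : Fin k → ℝ) = residual δ' q' t := by
  induction t with
  | zero => rfl
  | succ t ih =>
    simp only [residual]
    rw [ih (fun s hs => hδ s (by omega)) (fun s hs => hq s (by omega)), hδ t (by omega),
      hq t (by omega)]

/-- Time between the arrivals of the tasks at positions `t` and `t + 1`; it vanishes within a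
job. -/
def taskGap (k : ℕ) (a : ℕ → ℝ) (t : ℕ) : ℝ := a ((t + 1) / k) - a (t / k)

/-- Service time of the task at position `t`. -/
def taskService (q : ℕ → Fin k → ℝ) (t : ℕ) : ℝ := q (t / k) (Fin.ofNat k t)

lemma mul_add_val_div (n : ℕ) (i : Fin k) : (n * k + (i : ℕ)) / k = n := by
  rw [mul_comm, Nat.mul_add_div (Nat.pos_of_ne_zero (NeZero.ne k)), Nat.div_eq_of_lt i.2, add_zero]

lemma taskService_mul_add (q : ℕ → Fin k → ℝ) (n : ℕ) (i : Fin k) :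
    taskService q (n * k + i) = q n i := by
  have h2 : Fin.ofNat k (n * k + i) = i := by
    ext
    simp [Fin.ofNat, Nat.mod_eq_of_lt i.2]
  rw [taskService, mul_add_val_div, h2]

/-- For `residual`, the servers become idle only at the arrival of the first job, whereas they are
idle from time `0` on; apart from this, the two recursions agree. -/
lemma idleAt_dominated {a : ℕ → ℝ} (q : ℕ → Fin k → ℝ) (ha : 0 ≤ a 0) (t : ℕ) :
    Dominated (fun j => idleAt a q t j - a (t / k))
      (residual (taskGap k a) (taskService q) t) := by
  induction t with
  | zero => exact Dominated.of_le fun j => by simpa [idleAt, residual] using ha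
  | succ t ih =>
    have hmin : ∀ l, idleAt a q t (firstIdle (idleAt a q t)) - a (t / k)
        ≤ idleAt a q t l - a (t / k) := fun l => by simpa using firstIdle_le _ l
    have h := ((ih.update (i := firstIdle (idleAt a q t)) (firstIdle_le _)
      (v := max (a (t / k)) (idleAt a q t (firstIdle (idleAt a q t))) + taskService q t - a (t / k))
      (v' := max 0 (residual (taskGap k a) (taskService q) t
        (firstIdle (residual (k := k) (taskGap k a) (taskService q) t))) + taskService q t) (by
        have h1 := ih.min_le_min hmin
          (j := firstIdle (residual (k := k) (taskGap k a) (taskService q) t))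
        have h2 := max_le_max_left 0 h1
        rw [show (0 : ℝ) = a (t / k) - a (t / k) by ring, max_sub_sub_right, sub_self] at h2
        linarith)).sub_const (taskGap k a t))
    refine Eq.mp (congrArg₂ Dominated ?_ rfl) h
    funext j
    simp only [idleAt, taskGap, Function.update_apply, taskService]
    split_ifs <;> ring

lemma waitingTime_eq_delay (a : ℕ → ℝ) (q : ℕ → Fin k → ℝ) (n : ℕ) (i : Fin k) :
    waitingTime a q n i = max 0 (idleAt a q (n * k + i) (firstIdle (idleAt a q (n * k + i)))
      - a n) := by
  rw [waitingTime, startTime, show (0 : ℝ) = a n - a n by ring, max_sub_sub_right]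

lemma waitingTime_le_delay {a : ℕ → ℝ} (q : ℕ → Fin k → ℝ) (ha : 0 ≤ a 0) (n : ℕ) (i : Fin k) :
    waitingTime a q n i
      ≤ delay (residual (k := k) (taskGap k a) (taskService q) (n * k + i)) := by
  have h := idleAt_dominated q ha (n * k + i)
  rw [mul_add_val_div] at h
  rw [waitingTime_eq_delay, delay]
  exact max_le_max_left _ (h.min_le_min fun l => by simpa using firstIdle_le _ l)

lemma sojournTime_gt_iff (a : ℕ → ℝ) (q : ℕ → Fin k → ℝ) (n : ℕ) (τ : ℝ) :
    τ < sojournTime a q n ↔ ∃ i, τ < waitingTime a q n i + q n i := by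
  rw [sojournTime, departureTime, lt_sub_iff_add_lt, Finset.lt_sup'_iff]
  simp only [Finset.mem_univ, true_and, waitingTime]
  refine exists_congr fun i => ?_
  constructor <;> intro h <;> linarith

/-! ### Measurability -/

lemma measurable_firstIdle : Measurable (firstIdle : (Fin k → ℝ) → Fin k) := by
  refine measurable_to_countable' fun j => ?_
  have : firstIdle ⁻¹' {j} = {f : Fin k → ℝ | (∀ l, f j ≤ f l) ∧ ∀ l < j, ∃ m, f m < f l} := by
    ext f
    simpa using firstIdle_eq_iff f j
  rw [this]
  measurability

lemma measurable_apply_firstIdle : Measurable fun f : Fin k → ℝ => f (firstIdle f) := by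
  have h : Measurable fun p : (Fin k → ℝ) × Fin k => p.1 p.2 :=
    measurable_from_prod_countable_left fun j => measurable_pi_apply j
  exact h.comp (measurable_id.prodMk measurable_firstIdle)

lemma measurable_delay : Measurable (delay : (Fin k → ℝ) → ℝ) :=
  measurable_const.max measurable_apply_firstIdle

lemma measurable_update_firstIdle :
    Measurable fun p : (Fin k → ℝ) × ℝ => Function.update p.1 (firstIdle p.1) p.2 := by
  refine measurable_pi_iff.2 fun l => ?_
  simp only [Function.update_apply]
  refine Measurable.ite ?_ measurable_snd ((measurable_pi_apply l).comp measurable_fst)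
  exact measurableSet_eq_fun measurable_const (measurable_firstIdle.comp measurable_fst)

lemma measurable_serve : Measurable fun p : (Fin k → ℝ) × ℝ => serve p.1 p.2 :=
  measurable_update_firstIdle.comp (measurable_fst.prodMk
    ((measurable_delay.comp measurable_fst).add measurable_snd))

lemma measurable_serve_sub : Measurable fun p : (Fin k → ℝ) × (ℝ × ℝ) =>
    (fun j => serve p.1 p.2.1 j - p.2.2 : Fin k → ℝ) := by
  have h : Measurable fun p : (Fin k → ℝ) × (ℝ × ℝ) => (p.1, p.2.1) := by fun_prop
  refine measurable_pi_lambda _ fun j => Measurable.sub ?_ (by fun_prop)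
  exact (measurable_pi_apply j).comp (measurable_serve.comp h)

lemma measurable_residual (t : ℕ) :
    Measurable fun p : (ℕ → ℝ) × (ℕ → ℝ) => (residual p.1 p.2 t : Fin k → ℝ) := by
  induction t with
  | zero => exact measurable_const
  | succ t ih =>
    refine measurable_pi_iff.2 fun j => Measurable.sub ?_ ?_
    · exact (measurable_pi_apply j).comp (measurable_serve.comp
        (ih.prodMk ((measurable_pi_apply t).comp measurable_snd)))
    · exact (measurable_pi_apply t).comp measurable_fst

/-- The service times are listed by queue position, as a sequence. -/
lemma measurable_idleAt (t : ℕ) :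
    Measurable fun p : (ℕ → ℝ) × (ℕ → ℝ) =>
      idleAt p.1 (fun n (i : Fin k) => p.2 (n * k + i)) t := by
  induction t with
  | zero => exact measurable_const
  | succ t ih =>
    have h1 : Measurable fun p : (ℕ → ℝ) × (ℕ → ℝ) => p.1 (t / k) :=
      (measurable_pi_apply _).comp measurable_fst
    have h3 : Measurable fun p : (ℕ → ℝ) × (ℕ → ℝ) => p.2 (t / k * k + (Fin.ofNat k t : Fin k)) :=
      (measurable_pi_apply _).comp measurable_snd
    have key : ∀ F : (ℕ → ℝ) × (ℕ → ℝ) → Fin k → ℝ, Measurable F → Measurable fun p =>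
        Function.update (F p) (firstIdle (F p)) (max (p.1 (t / k)) (F p (firstIdle (F p)))
          + p.2 (t / k * k + (Fin.ofNat k t : Fin k))) := fun F hF =>
      measurable_update_firstIdle.comp
        (hF.prodMk ((h1.max (measurable_apply_firstIdle.comp hF)).add h3))
    exact key _ ih

lemma measurable_waitingTime (n : ℕ) (i : Fin k) :
    Measurable fun p : (ℕ → ℝ) × (ℕ → ℝ) =>
      waitingTime p.1 (fun n (i : Fin k) => p.2 (n * k + i)) n i := by
  simp only [waitingTime_eq_delay]
  exact measurable_const.max ((measurable_apply_firstIdle.comp (measurable_idleAt _)).sub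
    ((measurable_pi_apply n).comp measurable_fst))

lemma idleAt_congr {a : ℕ → ℝ} {q q' : ℕ → Fin k → ℝ} {t : ℕ}
    (hq : ∀ s < t, taskService q s = taskService q' s) : idleAt a q t = idleAt a q' t := by
  induction t with
  | zero => rfl
  | succ t ih =>
    have h := hq t (by omega)
    rw [taskService, taskService] at h
    simp only [idleAt]
    rw [ih fun s hs => hq s (by omega), h]

end ForkJoin

namespace ForkJoin

/-! ### Exponential random variables -/

open scoped ENNReal

lemma lintegral_expMeasure (r : ℝ) {f : ℝ → ℝ≥0∞} (hf : Measurable f) :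
    ∫⁻ x, f x ∂expMeasure r = ∫⁻ x, exponentialPDF r x * f x := by
  exact lintegral_withDensity_eq_lintegral_mul _ (measurable_gammaPDFReal 1 r).ennreal_ofReal hf

lemma noAtoms_expMeasure (r : ℝ) : NullSingletonClass (expMeasure r) :=
  ⟨fun x => withDensity_absolutelyContinuous _ _ (measure_singleton x)⟩

lemma expMeasure_Iic {r : ℝ} (hr : 0 < r) (a : ℝ) :
    expMeasure r (Set.Iic a) = ENNReal.ofReal (1 - Real.exp (-(r * max a 0))) := by
  have := isProbabilityMeasure_expMeasure hr
  rw [← ofReal_cdf, cdf_expMeasure_eq hr]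
  split_ifs with h
  · rw [max_eq_left h]
  · rw [max_eq_right (not_le.1 h).le]
    simp

lemma expMeasure_Ioi {r : ℝ} (hr : 0 < r) (a : ℝ) :
    expMeasure r (Set.Ioi a) = ENNReal.ofReal (Real.exp (-(r * max a 0))) := by
  have := isProbabilityMeasure_expMeasure hr
  have h1 : Real.exp (-(r * max a 0)) ≤ 1 :=
    Real.exp_le_one_iff.2 (neg_nonpos.2 (mul_nonneg hr.le (le_max_right _ _)))
  rw [← Set.compl_Iic, prob_compl_eq_one_sub measurableSet_Iic, expMeasure_Iic hr,
    ← ENNReal.ofReal_one, ← ENNReal.ofReal_sub _ (by linarith)]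
  congr 1
  ring

lemma expMeasure_Ici {r : ℝ} (hr : 0 < r) (a : ℝ) :
    expMeasure r (Set.Ici a) = ENNReal.ofReal (Real.exp (-(r * max a 0))) := by
  have := noAtoms_expMeasure r
  rw [← expMeasure_Ioi hr, measure_congr Ioi_ae_eq_Ici]

lemma ae_nonneg_expMeasure {r : ℝ} (hr : 0 < r) : ∀ᵐ x ∂expMeasure r, 0 ≤ x := by
  have := isProbabilityMeasure_expMeasure hr
  have h : expMeasure r (Set.Ici 0) = 1 := by rw [expMeasure_Ici hr]; simp
  exact (mem_ae_iff_prob_eq_one measurableSet_Ici).2 h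

/-- Exponential tilting of an exponential distribution changes its rate. -/
lemma lintegral_exp_mul_expMeasure {r s : ℝ} (hr : 0 < r) (hs : s < r) {G : ℝ → ℝ≥0∞}
    (hG : Measurable G) :
    ∫⁻ z, ENNReal.ofReal (Real.exp (s * z)) * G z ∂expMeasure r
      = ENNReal.ofReal (r / (r - s)) * ∫⁻ z, G z ∂expMeasure (r - s) := by
  have h0 : 0 < r - s := by linarith
  rw [lintegral_expMeasure _ (by fun_prop), lintegral_expMeasure _ hG,
    ← lintegral_const_mul _ (by unfold exponentialPDF; fun_prop)]
  refine lintegral_congr fun z => ?_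
  rw [← mul_assoc, ← mul_assoc]
  congr 1
  rw [exponentialPDF_eq, exponentialPDF_eq]
  split_ifs with hz
  · rw [← ENNReal.ofReal_mul (by positivity), ← ENNReal.ofReal_mul (by positivity)]
    congr 1
    rw [mul_assoc, ← Real.exp_add, ← mul_assoc, div_mul_cancel₀ _ h0.ne']
    congr 2
    ring
  · simp

lemma lintegral_exp_expMeasure {r s : ℝ} (hr : 0 < r) (hs : s < r) :
    ∫⁻ z, ENNReal.ofReal (Real.exp (s * z)) ∂expMeasure r = ENNReal.ofReal (r / (r - s)) := by
  have h0 : 0 < r - s := by linarith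
  have := isProbabilityMeasure_expMeasure h0
  simpa using lintegral_exp_mul_expMeasure hr hs (G := fun _ => 1) measurable_const

/-- Lack of memory. -/
lemma expMeasure_restrict_Ici {r z : ℝ} (hr : 0 < r) (hz : 0 ≤ z) :
    (expMeasure r).restrict (Set.Ici z)
      = ENNReal.ofReal (Real.exp (-(r * z))) • (expMeasure r).map (fun x => z + x) := by
  have := isProbabilityMeasure_expMeasure hr
  refine Measure.ext_of_Ici _ _ fun a => ?_
  have hpre : (fun x => z + x) ⁻¹' Set.Ici a = Set.Ici (a - z) := by
    ext x
    simp
  rw [Measure.restrict_apply measurableSet_Ici, Set.Ici_inter_Ici, Measure.smul_apply,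
    Measure.map_apply (by fun_prop) measurableSet_Ici, hpre, expMeasure_Ici hr, expMeasure_Ici hr,
    smul_eq_mul, ← ENNReal.ofReal_mul (Real.exp_pos _).le, ← Real.exp_add]
  congr 2
  have h1 : max (a ⊔ z) 0 = max a z := max_eq_left (le_max_of_le_right hz)
  have h2 : max (a - z) 0 = max a z - z := by
    rw [show (0 : ℝ) = z - z by ring, max_sub_sub_right]
  rw [h1, h2]
  ring

lemma pi_smul_const {m : ℕ} (c : ℝ≥0∞) (hc : c ≠ ⊤) (ν : Measure ℝ) [IsFiniteMeasure ν] :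
    Measure.pi (fun _ : Fin m => c • ν) = c ^ m • Measure.pi (fun _ : Fin m => ν) := by
  have := ν.smul_finite hc
  refine Measure.pi_eq fun s _ => ?_
  rw [Measure.smul_apply, Measure.pi_pi, smul_eq_mul]
  simp [Finset.prod_mul_distrib]

/-- Lack of memory of `m` independent exponential times that all exceed `z`. -/
lemma lintegral_pi_indicator_Ici {r z : ℝ} (hr : 0 < r) (hz : 0 ≤ z) {m : ℕ}
    {G : (Fin m → ℝ) → ℝ≥0∞} (hG : Measurable G) :
    ∫⁻ e, (Set.univ.pi fun _ => Set.Ici z).indicator G e ∂Measure.pi (fun _ => expMeasure r)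
      = ENNReal.ofReal (Real.exp (-(m * r) * z))
        * ∫⁻ e, G (fun l => z + e l) ∂Measure.pi (fun _ => expMeasure r) := by
  have := isProbabilityMeasure_expMeasure hr
  have hadd : Measurable fun x : ℝ => z + x := by fun_prop
  have : IsProbabilityMeasure ((expMeasure r).map (fun x => z + x)) :=
    Measure.isProbabilityMeasure_map hadd.aemeasurable
  rw [lintegral_indicator (MeasurableSet.univ_pi fun _ => measurableSet_Ici),
    Measure.restrict_pi_pi]
  simp only [expMeasure_restrict_Ici hr hz]
  rw [pi_smul_const _ ENNReal.ofReal_ne_top, lintegral_smul_measure,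
    ← Measure.pi_map_pi (fun _ => hadd.aemeasurable),
    lintegral_map hG (measurable_pi_lambda (fun (x : Fin m → ℝ) i => z + x i) fun i =>
      hadd.comp (measurable_pi_apply i)), ← ENNReal.ofReal_pow (Real.exp_pos _).le,
    ← Real.exp_nat_mul, smul_eq_mul]
  congr 3
  ring

lemma measurable_finCons {m : ℕ} :
    Measurable fun p : ℝ × (Fin m → ℝ) => (Fin.cons p.1 p.2 : Fin (m + 1) → ℝ) := by
  refine measurable_pi_iff.2 fun l => ?_
  cases l using Fin.cases with
  | zero => simpa using measurable_fst
  | succ l => exact (measurable_pi_apply l).comp measurable_snd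

lemma measurable_finCons_add {m : ℕ} :
    Measurable fun p : ℝ × (Fin m → ℝ) =>
      (Fin.cons p.1 (fun l => p.1 + p.2 l) : Fin (m + 1) → ℝ) := by
  refine measurable_pi_iff.2 fun l => ?_
  cases l using Fin.cases with
  | zero => exact measurable_fst
  | succ l => exact measurable_fst.add ((measurable_pi_apply l).comp measurable_snd)

/-- The first of `m + 1` independent exponential times of rate `r` is exponential with rate
`(m + 1) * r`, and the excesses of the others over it are again independent exponential times. The
functional `F` does not distinguish the coordinates, so that the first time may be listed as
coordinate `0`. -/
lemma lintegral_cons_expMeasure_le {r : ℝ} (hr : 0 < r) {m : ℕ} {F : (Fin (m + 1) → ℝ) → ℝ≥0∞}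
    (hF : Measurable F) (hswap : ∀ f i j, F (fun l => f (Equiv.swap i j l)) = F f) :
    ∫⁻ q, ∫⁻ e, F (Fin.cons q e) ∂Measure.pi (fun _ : Fin m => expMeasure r) ∂expMeasure r
      ≤ ∫⁻ z, ∫⁻ e, F (Fin.cons z fun l => z + e l) ∂Measure.pi (fun _ : Fin m => expMeasure r)
          ∂expMeasure ((m + 1) * r) := by
  have := isProbabilityMeasure_expMeasure hr
  set π := Measure.pi (fun _ : Fin (m + 1) => expMeasure r) with hπ
  have hsplit : ∀ H : (Fin (m + 1) → ℝ) → ℝ≥0∞, Measurable H →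
      ∫⁻ f, H f ∂π = ∫⁻ q, ∫⁻ e, H (Fin.cons q e) ∂Measure.pi (fun _ : Fin m => expMeasure r)
        ∂expMeasure r := by
    intro H hH
    have h := (measurePreserving_piFinSuccAbove (fun _ : Fin (m + 1) => expMeasure r) 0).symm
    rw [hπ, ← h.lintegral_comp hH]
    refine (lintegral_prod _ (hH.comp h.measurable).aemeasurable).trans ?_
    refine lintegral_congr fun q => lintegral_congr fun e => congrArg H ?_
    exact Fin.insertNth_zero' q e
  have hA : ∀ j : Fin (m + 1), MeasurableSet {f : Fin (m + 1) → ℝ | ∀ l, f j ≤ f l} := by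
    intro j
    measurability
  -- the event that coordinate `j` is minimal has the same contribution for every `j`
  have hsym : ∀ j : Fin (m + 1), ∫⁻ f, {f | ∀ l, f j ≤ f l}.indicator F f ∂π
      = ∫⁻ f, {f | ∀ l, f 0 ≤ f l}.indicator F f ∂π := by
    intro j
    have h := measurePreserving_piCongrLeft (fun _ : Fin (m + 1) => expMeasure r) (Equiv.swap 0 j)
    rw [hπ, ← h.lintegral_comp (hF.indicator (hA j))]
    refine lintegral_congr fun f => ?_
    have e : MeasurableEquiv.piCongrLeft (fun _ => ℝ) (Equiv.swap 0 j) f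
        = fun l => f (Equiv.swap 0 j l) := by
      funext l
      obtain ⟨l, rfl⟩ := (Equiv.swap 0 j).surjective l
      rw [MeasurableEquiv.coe_piCongrLeft, Equiv.piCongrLeft_apply_apply]
      simp
    rw [e]
    simp only [Set.indicator, Set.mem_ofPred_eq, hswap, Equiv.swap_apply_right]
    have : (∀ l, f 0 ≤ f (Equiv.swap 0 j l)) ↔ ∀ l, f 0 ≤ f l :=
      (Equiv.swap 0 j).forall_congr_left.trans (by simp)
    simp only [this]
    congr
  have hrate : ((m : ℝ) + 1) * r = r - -(m * r) := by ring
  have hlt : -(m * r) < r := by nlinarith [(Nat.cast_nonneg m : (0 : ℝ) ≤ m)]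
  have hG : Measurable fun z : ℝ => ∫⁻ e, F (Fin.cons z fun l => z + e l)
      ∂Measure.pi (fun _ : Fin m => expMeasure r) :=
    (hF.comp measurable_finCons_add).lintegral_prod_right'
  have hfirst : ∫⁻ f, {f | ∀ l, f 0 ≤ f l}.indicator F f ∂π
      = ENNReal.ofReal (r / ((m + 1) * r)) * ∫⁻ z, ∫⁻ e, F (Fin.cons z fun l => z + e l)
        ∂Measure.pi (fun _ : Fin m => expMeasure r) ∂expMeasure ((m + 1) * r) := by
    rw [hsplit _ (hF.indicator (hA 0)), hrate, ← lintegral_exp_mul_expMeasure hr hlt hG]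
    refine lintegral_congr_ae ?_
    filter_upwards [ae_nonneg_expMeasure hr] with z hz
    rw [← lintegral_pi_indicator_Ici hr hz (G := fun e => F (Fin.cons z e))
      (hF.comp (measurable_finCons.comp (measurable_const.prodMk measurable_id)))]
    refine lintegral_congr fun e => ?_
    simp only [Set.indicator, Set.mem_ofPred_eq, Fin.forall_fin_succ, Fin.cons_zero, Fin.cons_succ,
      Set.mem_univ_pi, Set.mem_Ici, le_refl, true_and]
  calc ∫⁻ q, ∫⁻ e, F (Fin.cons q e) ∂Measure.pi (fun _ : Fin m => expMeasure r) ∂expMeasure r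
      = ∫⁻ f, F f ∂π := (hsplit F hF).symm
    _ ≤ ∫⁻ f, ∑ j : Fin (m + 1), {f | ∀ l, f j ≤ f l}.indicator F f ∂π := by
        refine lintegral_mono fun f => ?_
        obtain ⟨j, hj⟩ := Finite.exists_min f
        refine le_trans (le_of_eq ?_) (Finset.single_le_sum (f := fun j : Fin (m + 1) =>
          {f | ∀ l, f j ≤ f l}.indicator F f) (fun _ _ => zero_le) (Finset.mem_univ j))
        exact (Set.indicator_of_mem (show f ∈ {f | ∀ l, f j ≤ f l} from hj) F).symm
    _ = ∑ j : Fin (m + 1), ∫⁻ f, {f | ∀ l, f 0 ≤ f l}.indicator F f ∂π := by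
        rw [lintegral_finsetSum _ fun j _ => hF.indicator (hA j)]
        exact Finset.sum_congr rfl fun j _ => hsym j
    _ = _ := by
        have hm : (0 : ℝ) < m + 1 := by positivity
        rw [Finset.sum_const, Finset.card_univ, Fintype.card_fin, hfirst, nsmul_eq_mul,
          ← mul_assoc, ← ENNReal.ofReal_natCast, ← ENNReal.ofReal_mul (by positivity)]
        have : ((m + 1 : ℕ) : ℝ) * (r / ((m + 1) * r)) = 1 := by
          push_cast
          field_simp
        rw [this, ENNReal.ofReal_one, one_mul]

end ForkJoin

namespace ForkJoin

open scoped ENNReal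

/-! ### Comparison with a single server of rate `k * μ` -/

/-- Laws of the single-server recursion `Y₀ = 0`, `Yₜ₊₁ = max 0 Yₜ + Zₜ - δₜ` with independent
exponential `Zₜ` of rate `κ` and `δₜ` of law `η t`; `max 0 Yₜ` is a waiting time. -/
noncomputable def waitLaw (κ : ℝ) (η : ℕ → Measure ℝ) : ℕ → Measure ℝ
  | 0 => Measure.dirac 0
  | t + 1 => ((waitLaw κ η t).prod ((expMeasure κ).prod (η t))).map
      fun p => max 0 p.1 + p.2.1 - p.2.2

lemma isProbabilityMeasure_waitLaw {κ : ℝ} (hκ : 0 < κ) {η : ℕ → Measure ℝ}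
    (hη : ∀ t, IsProbabilityMeasure (η t)) (t : ℕ) : IsProbabilityMeasure (waitLaw κ η t) := by
  induction t with
  | zero => exact Measure.dirac.isProbabilityMeasure
  | succ t ih =>
    have := isProbabilityMeasure_expMeasure hκ
    have := hη t
    exact Measure.isProbabilityMeasure_map (by fun_prop)

lemma lintegral_waitLaw_succ {κ : ℝ} (hκ : 0 < κ) {η : ℕ → Measure ℝ}
    (hη : ∀ t, IsProbabilityMeasure (η t)) (t : ℕ) {g : ℝ → ℝ≥0∞} (hg : Measurable g) :
    ∫⁻ y, g y ∂waitLaw κ η (t + 1) = ∫⁻ y, ∫⁻ z, ∫⁻ d, g (max 0 y + z - d) ∂η t ∂expMeasure κ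
      ∂waitLaw κ η t := by
  have := isProbabilityMeasure_expMeasure hκ
  have := hη t
  have := isProbabilityMeasure_waitLaw hκ hη t
  rw [waitLaw, lintegral_map hg (by fun_prop), lintegral_prod _ (by fun_prop)]
  refine lintegral_congr fun y => ?_
  rw [lintegral_prod _ (by fun_prop)]

lemma ae_pi_expMeasure_nonneg {r : ℝ} (hr : 0 < r) (m : ℕ) :
    ∀ᵐ e ∂Measure.pi (fun _ : Fin m => expMeasure r), ∀ l, 0 ≤ e l := by
  have := isProbabilityMeasure_expMeasure hr
  exact ae_all_iff.2 fun l =>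
    (Measure.tendsto_eval_ae_ae (μ := fun _ : Fin m => expMeasure r) (i := l)).eventually
      (ae_nonneg_expMeasure hr)

/-- A task that finds one server becoming idle at time `y` and exponential remaining times at the
others starts at `max 0 y`. It leaves all `m + 1` servers with exponential remaining times, the
shortest of which is exponential of rate `(m + 1) * μ`. -/
lemma lintegral_serve_le {μ : ℝ} (hμ : 0 < μ) {m : ℕ} {ν : Measure ℝ} [IsProbabilityMeasure ν]
    {F : (Fin (m + 1) → ℝ) → ℝ≥0∞} (hF : Measurable F)
    (hmono : ∀ f f', Dominated f f' → F f ≤ F f') (y : ℝ) :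
    ∫⁻ e, ∫⁻ p, F (fun j => serve (Fin.cons y fun l => y + e l : Fin (m + 1) → ℝ) p.1 j - p.2)
        ∂(expMeasure μ).prod ν ∂Measure.pi (fun _ : Fin m => expMeasure μ)
      ≤ ∫⁻ z, ∫⁻ d, ∫⁻ e, F (Fin.cons (max 0 y + z - d) fun l => max 0 y + z - d + e l)
        ∂Measure.pi (fun _ : Fin m => expMeasure μ) ∂ν ∂expMeasure ((m + 1) * μ) := by
  have := isProbabilityMeasure_expMeasure hμ
  have hκ : 0 < ((m : ℝ) + 1) * μ := by positivity
  have := isProbabilityMeasure_expMeasure hκ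
  have hG : Measurable fun y : ℝ => ∫⁻ e, F (Fin.cons y fun l => y + e l)
      ∂Measure.pi (fun _ : Fin m => expMeasure μ) :=
    (hF.comp measurable_finCons_add).lintegral_prod_right'
  have hshift : ∀ c : ℝ, Measurable fun f : Fin (m + 1) → ℝ => F fun j => f j + c := fun c =>
    hF.comp (measurable_pi_lambda _ fun j => (measurable_pi_apply j).add measurable_const)
  have hcons : Measurable fun p : (Fin m → ℝ) × (ℝ × ℝ) =>
      F (fun j => (Fin.cons p.2.1 p.1 : Fin (m + 1) → ℝ) j + (max 0 y - p.2.2)) := by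
    have h : Measurable fun p : (Fin m → ℝ) × (ℝ × ℝ) =>
        (Fin.cons p.2.1 p.1 : Fin (m + 1) → ℝ) :=
      measurable_finCons.comp ((measurable_fst.comp measurable_snd).prodMk measurable_fst)
    exact hF.comp (measurable_pi_lambda _ fun j => ((measurable_pi_apply j).comp h).add
      (measurable_const.sub (measurable_snd.comp measurable_snd)))
  have hdz : Measurable fun p : ℝ × ℝ => ∫⁻ e, F (Fin.cons (max 0 y + p.1 - p.2)
      fun l => max 0 y + p.1 - p.2 + e l) ∂Measure.pi (fun _ : Fin m => expMeasure μ) :=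
    hG.comp (by fun_prop : Measurable fun p : ℝ × ℝ => max 0 y + p.1 - p.2)
  calc ∫⁻ e, ∫⁻ p, F (fun j => serve (Fin.cons y fun l => y + e l : Fin (m + 1) → ℝ) p.1 j - p.2)
        ∂(expMeasure μ).prod ν ∂Measure.pi (fun _ : Fin m => expMeasure μ)
      ≤ ∫⁻ e, ∫⁻ p, F (fun j => (Fin.cons p.1 e : Fin (m + 1) → ℝ) j + (max 0 y - p.2))
          ∂(expMeasure μ).prod ν ∂Measure.pi (fun _ : Fin m => expMeasure μ) := by
        refine lintegral_mono_ae ?_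
        filter_upwards [ae_pi_expMeasure_nonneg hμ m] with e he
        refine lintegral_mono fun p => hmono _ _ ?_
        set f : Fin (m + 1) → ℝ := Fin.cons y fun l => y + e l with hf
        have hdom : Dominated f (Fin.cons (max 0 y) fun l => max 0 y + e l) :=
          Dominated.of_le fun j => by
            cases j using Fin.cases with
            | zero => simp [hf]
            | succ l => simp [hf]
        have hmin : ∀ l, (Fin.cons (max 0 y) fun l => max 0 y + e l : Fin (m + 1) → ℝ) 0
            ≤ (Fin.cons (max 0 y) fun l => max 0 y + e l : Fin (m + 1) → ℝ) l := fun l => by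
          cases l using Fin.cases with
          | zero => simp
          | succ l => simpa using he l
        have hv : max 0 (f (firstIdle f)) + p.1 ≤ max 0 y + p.1 := by
          have := firstIdle_le f 0
          rw [hf, Fin.cons_zero] at this
          gcongr
        obtain ⟨σ, hσ⟩ := hdom.update (i := firstIdle f) hmin hv
        refine ⟨σ, fun j => (sub_le_sub_right (hσ j) p.2).trans (le_of_eq ?_)⟩
        cases j using Fin.cases with
        | zero => simp; ring
        | succ l => simp; ring
    _ = ∫⁻ p, ∫⁻ e, F (fun j => (Fin.cons p.1 e : Fin (m + 1) → ℝ) j + (max 0 y - p.2))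
          ∂Measure.pi (fun _ : Fin m => expMeasure μ) ∂(expMeasure μ).prod ν :=
        lintegral_lintegral_swap hcons.aemeasurable
    _ = ∫⁻ d, ∫⁻ z, ∫⁻ e, F (fun j => (Fin.cons z e : Fin (m + 1) → ℝ) j + (max 0 y - d))
          ∂Measure.pi (fun _ : Fin m => expMeasure μ) ∂expMeasure μ ∂ν :=
        lintegral_prod_symm _ hcons.lintegral_prod_left'.aemeasurable
    _ ≤ ∫⁻ d, ∫⁻ z, ∫⁻ e, F (Fin.cons (max 0 y + z - d) fun l => max 0 y + z - d + e l)
          ∂Measure.pi (fun _ : Fin m => expMeasure μ) ∂expMeasure ((m + 1) * μ) ∂ν := by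
        refine lintegral_mono fun d => ?_
        refine (lintegral_cons_expMeasure_le hμ (hshift (max 0 y - d)) fun f i j => ?_).trans
          (le_of_eq ?_)
        · refine le_antisymm (hmono _ _ ⟨Equiv.swap i j, fun l => by simp⟩)
            (hmono _ _ ⟨Equiv.swap i j, fun l => le_rfl⟩)
        · refine lintegral_congr fun z => lintegral_congr fun e => congrArg F (funext fun j => ?_)
          cases j using Fin.cases with
          | zero => simp; ring
          | succ l => simp; ring
    _ = _ := lintegral_lintegral_swap (hdz.comp measurable_swap).aemeasurable

variable {Ω : Type*} [MeasurableSpace Ω] {P : Measure Ω}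

/-- All servers being busy is the worst case: in the dominating state a server becomes idle at time
`y`, distributed as in the single-server recursion, and the others keep independent exponential
remaining times. -/
lemma lintegral_residual_le [IsProbabilityMeasure P] {μ : ℝ} (hμ : 0 < μ) {m : ℕ}
    {δ q : ℕ → Ω → ℝ}
    (hδ : ∀ t, Measurable (δ t)) (hq : ∀ t, Measurable (q t))
    (hq_law : ∀ t, P.map (q t) = expMeasure μ)
    (h_indep : ∀ t, IndepFun (fun ω => (residual (fun s => δ s ω) (fun s => q s ω) t :
      Fin (m + 1) → ℝ)) (fun ω => (q t ω, δ t ω)) P)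
    (h_indep' : ∀ t, IndepFun (q t) (δ t) P) (t : ℕ) {F : (Fin (m + 1) → ℝ) → ℝ≥0∞}
    (hF : Measurable F) (hmono : ∀ f f', Dominated f f' → F f ≤ F f') :
    ∫⁻ ω, F (residual (fun s => δ s ω) (fun s => q s ω) t) ∂P
      ≤ ∫⁻ y, ∫⁻ e, F (Fin.cons y fun l => y + e l) ∂Measure.pi (fun _ : Fin m => expMeasure μ)
        ∂waitLaw ((m + 1) * μ) (fun t => P.map (δ t)) t := by
  have := isProbabilityMeasure_expMeasure hμ
  have hκ : 0 < ((m : ℝ) + 1) * μ := by positivity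
  have := isProbabilityMeasure_expMeasure hκ
  have hη : ∀ t, IsProbabilityMeasure (P.map (δ t)) := fun t =>
    Measure.isProbabilityMeasure_map (hδ t).aemeasurable
  induction t generalizing F with
  | zero =>
    have : ∫⁻ ω, F (residual (fun s => δ s ω) (fun s => q s ω) 0) ∂P = F 0 := by
      simp [residual]
    have hmeas : Measurable fun y : ℝ => ∫⁻ e, F (Fin.cons y fun l => y + e l)
        ∂Measure.pi (fun _ : Fin m => expMeasure μ) :=
      (hF.comp measurable_finCons_add).lintegral_prod_right'
    rw [this, waitLaw, lintegral_dirac' _ hmeas]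
    calc F 0 = ∫⁻ _, F 0 ∂Measure.pi (fun _ : Fin m => expMeasure μ) := by simp
      _ ≤ _ := by
        refine lintegral_mono_ae ?_
        filter_upwards [ae_pi_expMeasure_nonneg hμ m] with e he
        refine hmono _ _ (Dominated.of_le fun j => ?_)
        cases j using Fin.cases with
        | zero => simp
        | succ l => simpa using he l
  | succ t ih =>
    -- condition on the state at `t` and apply the induction hypothesis to the functional `F'`,
    -- which is again monotone for domination
    set η := fun t => P.map (δ t) with hη_def
    have := hη t
    have hFs : Measurable fun p : (Fin (m + 1) → ℝ) × (ℝ × ℝ) =>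
        F (fun j => serve p.1 p.2.1 j - p.2.2) := hF.comp measurable_serve_sub
    set F' : (Fin (m + 1) → ℝ) → ℝ≥0∞ := fun f =>
      ∫⁻ p, F (fun j => serve f p.1 j - p.2) ∂(expMeasure μ).prod (η t) with hF'
    have hF'_meas : Measurable F' := hFs.lintegral_prod_right'
    have hF'_mono : ∀ f f', Dominated f f' → F' f ≤ F' f' := fun f f' h =>
      lintegral_mono fun p => hmono _ _ ((h.serve p.1).sub_const p.2)
    have hres : Measurable fun ω => (residual (fun s => δ s ω) (fun s => q s ω) t :
        Fin (m + 1) → ℝ) :=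
      (measurable_residual t).comp ((measurable_pi_lambda _ hδ).prodMk (measurable_pi_lambda _ hq))
    have hpair : P.map (fun ω => (q t ω, δ t ω)) = (expMeasure μ).prod (η t) := by
      rw [(indepFun_iff_map_prod_eq_prod_map_map (hq t).aemeasurable (hδ t).aemeasurable).1
        (h_indep' t), hq_law]
    have hjoint := (indepFun_iff_map_prod_eq_prod_map_map hres.aemeasurable
      ((hq t).prodMk (hδ t)).aemeasurable).1 (h_indep t)
    have hlhs : ∫⁻ ω, F (residual (fun s => δ s ω) (fun s => q s ω) (t + 1)) ∂P
        = ∫⁻ ω, F' (residual (fun s => δ s ω) (fun s => q s ω) t) ∂P := by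
      calc ∫⁻ ω, F (residual (fun s => δ s ω) (fun s => q s ω) (t + 1)) ∂P
          = ∫⁻ p, F (fun j => serve p.1 p.2.1 j - p.2.2) ∂P.map (fun ω =>
              ((residual (fun s => δ s ω) (fun s => q s ω) t : Fin (m + 1) → ℝ),
                (q t ω, δ t ω))) := by
            rw [lintegral_map hFs (hres.prodMk ((hq t).prodMk (hδ t)))]
            rfl
        _ = ∫⁻ f, F' f ∂P.map (fun ω => residual (fun s => δ s ω) (fun s => q s ω) t) := by
            rw [hjoint, hpair, lintegral_prod _ hFs.aemeasurable]
        _ = _ := lintegral_map hF'_meas hres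
    rw [hlhs]
    refine (ih hF'_meas hF'_mono).trans ?_
    have hG : Measurable fun y : ℝ => ∫⁻ e, F (Fin.cons y fun l => y + e l)
        ∂Measure.pi (fun _ : Fin m => expMeasure μ) :=
      (hF.comp measurable_finCons_add).lintegral_prod_right'
    rw [lintegral_waitLaw_succ hκ hη t hG]
    refine lintegral_mono fun y => ?_
    exact lintegral_serve_le hμ hF hmono y

/-- The waiting time of the task at position `t` is stochastically at most that of the single-server
recursion. -/
lemma lintegral_delay_le [IsProbabilityMeasure P] {k : ℕ} [NeZero k] {μ : ℝ} (hμ : 0 < μ)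
    {δ q : ℕ → Ω → ℝ}
    (hδ : ∀ t, Measurable (δ t)) (hq : ∀ t, Measurable (q t))
    (hq_law : ∀ t, P.map (q t) = expMeasure μ)
    (h_indep : ∀ t, IndepFun (fun ω => (residual (fun s => δ s ω) (fun s => q s ω) t :
      Fin k → ℝ)) (fun ω => (q t ω, δ t ω)) P)
    (h_indep' : ∀ t, IndepFun (q t) (δ t) P) (t : ℕ) {g : ℝ → ℝ≥0∞}
    (hg : Measurable g) (hmono : Monotone g) :
    ∫⁻ ω, g (delay (residual (fun s => δ s ω) (fun s => q s ω) t : Fin k → ℝ)) ∂P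
      ≤ ∫⁻ y, g (max 0 y) ∂waitLaw (k * μ) (fun t => P.map (δ t)) t := by
  obtain ⟨m, rfl⟩ := Nat.exists_eq_succ_of_ne_zero (NeZero.ne k)
  have := isProbabilityMeasure_expMeasure hμ
  have h := lintegral_residual_le hμ hδ hq hq_law h_indep h_indep' t
    (F := fun f => g (delay f)) (hg.comp measurable_delay) fun f f' h => hmono h.delay_le
  refine h.trans ?_
  rw [Nat.succ_eq_add_one, Nat.cast_add_one]
  refine lintegral_mono fun y => ?_
  calc ∫⁻ e, g (delay (Fin.cons y fun l => y + e l : Fin (m + 1) → ℝ))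
        ∂Measure.pi (fun _ : Fin m => expMeasure μ)
      ≤ ∫⁻ _, g (max 0 y) ∂Measure.pi (fun _ : Fin m => expMeasure μ) :=
        lintegral_mono fun e => hmono (max_le_max_left _ (firstIdle_le _ 0))
    _ = g (max 0 y) := by simp

end ForkJoin

namespace ForkJoin

open scoped ENNReal

/-! ### Tail bounds for the single-server recursion -/

/-- The law of the sum of `j` independent exponential variables of rate `κ`. -/
noncomputable def erlang (κ : ℝ) : ℕ → Measure ℝ
  | 0 => Measure.dirac 0
  | j + 1 => ((erlang κ j).prod (expMeasure κ)).map fun p => p.1 + p.2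

lemma isProbabilityMeasure_erlang {κ : ℝ} (hκ : 0 < κ) (j : ℕ) :
    IsProbabilityMeasure (erlang κ j) := by
  induction j with
  | zero => exact Measure.dirac.isProbabilityMeasure
  | succ j ih =>
    have := isProbabilityMeasure_expMeasure hκ
    exact Measure.isProbabilityMeasure_map (by fun_prop)

lemma lintegral_erlang_succ {κ : ℝ} (hκ : 0 < κ) (j : ℕ) {g : ℝ → ℝ≥0∞} (hg : Measurable g) :
    ∫⁻ x, g x ∂erlang κ (j + 1) = ∫⁻ x, ∫⁻ z, g (x + z) ∂expMeasure κ ∂erlang κ j := by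
  have := isProbabilityMeasure_expMeasure hκ
  have := isProbabilityMeasure_erlang hκ j
  rw [erlang, lintegral_map hg (by fun_prop), lintegral_prod _ (by fun_prop)]

lemma ae_nonneg_erlang {κ : ℝ} (hκ : 0 < κ) (j : ℕ) : ∀ᵐ x ∂erlang κ j, 0 ≤ x := by
  have := isProbabilityMeasure_expMeasure hκ
  have hmeas : MeasurableSet {x : ℝ | 0 ≤ x} := measurableSet_Ici
  induction j with
  | zero => rw [erlang, ae_dirac_iff hmeas]
  | succ j ih =>
    have := isProbabilityMeasure_erlang hκ j
    rw [erlang, ae_map_iff (by fun_prop) hmeas]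
    have h : MeasurableSet {p : ℝ × ℝ | 0 ≤ p.1 + p.2} := by measurability
    rw [Measure.ae_prod_iff_ae_ae h]
    filter_upwards [ih] with x hx
    filter_upwards [ae_nonneg_expMeasure hκ] with z hz
    exact add_nonneg hx hz

lemma lintegral_exp_erlang {κ s : ℝ} (hκ : 0 < κ) (hs : s < κ) (j : ℕ) :
    ∫⁻ x, ENNReal.ofReal (Real.exp (s * x)) ∂erlang κ j
      = ENNReal.ofReal ((κ / (κ - s)) ^ j) := by
  have h0 : 0 < κ - s := by linarith
  induction j with
  | zero => rw [erlang, lintegral_dirac' _ (by fun_prop)]; simp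
  | succ j ih =>
    rw [lintegral_erlang_succ hκ j (by fun_prop)]
    simp_rw [mul_add, Real.exp_add, ENNReal.ofReal_mul (Real.exp_pos _).le]
    simp_rw [lintegral_const_mul _ (by fun_prop : Measurable fun z : ℝ =>
      ENNReal.ofReal (Real.exp (s * z))), lintegral_exp_expMeasure hκ hs]
    rw [lintegral_mul_const _ (by fun_prop), ih, ← ENNReal.ofReal_mul (by positivity), pow_succ]

lemma erlang_Ioi_le {κ θ : ℝ} (hκ : 0 < κ) (hθ : 0 < θ) (hθκ : θ < κ) (j : ℕ) (u : ℝ) :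
    erlang κ j (Set.Ioi u) ≤ ENNReal.ofReal ((κ / (κ - θ)) ^ j * Real.exp (-θ * u)) := by
  have h0 : 0 < κ - θ := by linarith
  calc erlang κ j (Set.Ioi u) = ∫⁻ x, (Set.Ioi u).indicator 1 x ∂erlang κ j :=
        (lintegral_indicator_one measurableSet_Ioi).symm
    _ ≤ ∫⁻ x, ENNReal.ofReal (Real.exp (θ * x)) * ENNReal.ofReal (Real.exp (-θ * u))
          ∂erlang κ j := by
        refine lintegral_mono fun x => ?_
        by_cases hx : u < x
        · rw [Set.indicator_of_mem (Set.mem_Ioi.2 hx), ← ENNReal.ofReal_mul (Real.exp_pos _).le,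
            ← Real.exp_add, Pi.one_apply, ENNReal.one_le_ofReal]
          exact Real.one_le_exp (by nlinarith)
        · rw [Set.indicator_of_notMem (by simpa using hx)]
          exact zero_le
    _ = _ := by
        rw [lintegral_mul_const _ (by fun_prop), lintegral_exp_erlang hκ hθκ,
          ← ENNReal.ofReal_mul (by positivity)]

/-- For deterministic arrival times, the bound by a sum over the job `m` that starts the busy
period, `k` stages being served for each job from `m` on. Only a new job adds a term, since within
a job the maximum with zero is redundant. -/
lemma lintegral_waitLaw_dirac_le {κ : ℝ} (hκ : 0 < κ) {k : ℕ} (a : ℕ → ℝ) (t : ℕ)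
    {g : ℝ → ℝ≥0∞} (hg : Measurable g) :
    ∫⁻ y, g (max 0 y) ∂waitLaw κ (fun t => Measure.dirac (taskGap k a t)) t
      ≤ ∑ m ∈ Finset.range (t / k + 1), ∫⁻ x, g (x + (a m - a (t / k)))
          ∂erlang κ (t - m * k) := by
  have := isProbabilityMeasure_expMeasure hκ
  have hη : ∀ t, IsProbabilityMeasure (Measure.dirac (taskGap k a t)) := fun t =>
    Measure.dirac.isProbabilityMeasure
  induction t generalizing g with
  | zero =>
    simp only [waitLaw, Nat.zero_div, zero_add, Finset.range_one, Finset.sum_singleton, zero_mul,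
      tsub_self, erlang]
    rw [lintegral_dirac' _ (by fun_prop), lintegral_dirac' _ (by fun_prop)]
    simp
  | succ t ih =>
    rw [lintegral_waitLaw_succ hκ hη t (g := fun y => g (max 0 y)) (by fun_prop)]
    have hd : ∀ y z : ℝ, ∫⁻ d, g (max 0 (max 0 y + z - d)) ∂Measure.dirac (taskGap k a t)
        = g (max 0 (max 0 y + z - taskGap k a t)) := fun y z =>
      lintegral_dirac' _ (by fun_prop)
    simp only [hd]
    have hgz : ∀ c : ℝ, Measurable fun w => ∫⁻ z, g (w + z - c) ∂expMeasure κ := fun c => by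
      have : Measurable fun p : ℝ × ℝ => g (p.1 + p.2 - c) := by fun_prop
      exact this.lintegral_prod_right'
    -- one more stage for each of the terms at `t`
    have hterm : ∀ m ≤ t / k, ∫⁻ x, ∫⁻ z, g (x + (a m - a (t / k)) + z - taskGap k a t)
        ∂expMeasure κ ∂erlang κ (t - m * k)
        = ∫⁻ x, g (x + (a m - a ((t + 1) / k))) ∂erlang κ (t + 1 - m * k) := by
      intro m hm
      have : m * k ≤ t := (Nat.mul_le_mul_right k hm).trans (Nat.div_mul_le_self t k)
      rw [Nat.succ_sub this, lintegral_erlang_succ hκ _ (by fun_prop)]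
      refine lintegral_congr fun x => lintegral_congr fun z => congrArg g ?_
      rw [taskGap]
      ring
    by_cases hdiv : k ∣ t + 1
    · have hsucc : (t + 1) / k = t / k + 1 := Nat.succ_div_of_dvd hdiv
      have hlast : t + 1 - (t / k + 1) * k = 0 := by
        rw [← hsucc, Nat.div_mul_cancel hdiv, tsub_self]
      have hpt : ∀ v : ℝ, g (max 0 v) ≤ g v + g 0 := fun v => by
        rcases le_total 0 v with h | h
        · rw [max_eq_right h]; exact le_self_add
        · rw [max_eq_left h]; exact le_add_self
      have := isProbabilityMeasure_waitLaw hκ hη t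
      calc ∫⁻ y, ∫⁻ z, g (max 0 (max 0 y + z - taskGap k a t)) ∂expMeasure κ
            ∂waitLaw κ (fun t => Measure.dirac (taskGap k a t)) t
          ≤ ∫⁻ y, ∫⁻ z, (g (max 0 y + z - taskGap k a t) + g 0) ∂expMeasure κ
            ∂waitLaw κ (fun t => Measure.dirac (taskGap k a t)) t :=
            lintegral_mono fun y => lintegral_mono fun z => hpt _
        _ = ∫⁻ y, ∫⁻ z, g (max 0 y + z - taskGap k a t) ∂expMeasure κ
            ∂waitLaw κ (fun t => Measure.dirac (taskGap k a t)) t + g 0 := by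
            simp_rw [lintegral_add_right _ (measurable_const : Measurable fun _ : ℝ => g 0)]
            rw [lintegral_add_right _ measurable_const]
            simp
        _ ≤ ∑ m ∈ Finset.range (t / k + 1), ∫⁻ x, ∫⁻ z,
              g (x + (a m - a (t / k)) + z - taskGap k a t) ∂expMeasure κ
              ∂erlang κ (t - m * k) + g 0 :=
            add_le_add_left (ih (hgz (taskGap k a t))) _
        _ = ∑ m ∈ Finset.range (t / k + 1), ∫⁻ x, g (x + (a m - a ((t + 1) / k)))
              ∂erlang κ (t + 1 - m * k) + g 0 := by
            congr 1
            exact Finset.sum_congr rfl fun m hm => hterm m (by simpa [Nat.lt_succ_iff] using hm)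
        _ = _ := by
            rw [hsucc, Finset.sum_range_succ _ (t / k + 1), hlast, erlang,
              lintegral_dirac' _ (by fun_prop)]
            simp
    · have hsucc : (t + 1) / k = t / k := Nat.succ_div_of_not_dvd hdiv
      have hgap : taskGap k a t = 0 := by rw [taskGap, hsucc, sub_self]
      calc ∫⁻ y, ∫⁻ z, g (max 0 (max 0 y + z - taskGap k a t)) ∂expMeasure κ
            ∂waitLaw κ (fun t => Measure.dirac (taskGap k a t)) t
          = ∫⁻ y, ∫⁻ z, g (max 0 y + z - taskGap k a t) ∂expMeasure κ
            ∂waitLaw κ (fun t => Measure.dirac (taskGap k a t)) t := by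
            refine lintegral_congr fun y => lintegral_congr_ae ?_
            filter_upwards [ae_nonneg_expMeasure hκ] with z hz
            rw [hgap, sub_zero, max_eq_right (add_nonneg (le_max_left _ _) hz)]
        _ ≤ _ := ih (hgz (taskGap k a t))
        _ = _ := by
            rw [hsucc]
            exact Finset.sum_congr rfl fun m hm => (hterm m (by
              simpa [Nat.lt_succ_iff] using hm)).trans (by rw [hsucc])

/-- The bound of Kingman. The exponential moment of the increments over one job is at most one, so
that the exponential bound is reproduced with each job. -/
lemma waitLaw_gt_le {κ θ : ℝ} (hκ : 0 < κ) (hθ : 0 < θ) (hθκ : θ < κ) {k : ℕ} (hk : 0 < k)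
    {η : ℕ → Measure ℝ} (hη : ∀ t, IsProbabilityMeasure (η t))
    (h_within : ∀ t, ¬ k ∣ t + 1 → η t = Measure.dirac 0)
    (h_gap : ∀ t, k ∣ t + 1 → ENNReal.ofReal ((κ / (κ - θ)) ^ k)
      * ∫⁻ d, ENNReal.ofReal (Real.exp (-θ * d)) ∂η t ≤ 1) (t : ℕ) (u : ℝ) :
    waitLaw κ η t {y | u < max 0 y}
      ≤ ENNReal.ofReal ((κ / (κ - θ)) ^ (t % k) * Real.exp (-θ * u)) := by
  have h0 : 0 < κ - θ := by linarith
  have hc : 1 ≤ κ / (κ - θ) := by rw [le_div_iff₀ h0]; linarith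
  have := isProbabilityMeasure_expMeasure hκ
  have hmeas : ∀ u : ℝ, MeasurableSet {y : ℝ | u < max 0 y} := fun u =>
    measurableSet_lt measurable_const (by fun_prop)
  induction t generalizing u with
  | zero =>
    rw [waitLaw, Measure.dirac_apply' _ (hmeas u)]
    by_cases h : u < 0
    · rw [Set.indicator_of_mem (by simpa using h), Nat.zero_mod, pow_zero, one_mul, Pi.one_apply,
        ENNReal.one_le_ofReal]
      exact Real.one_le_exp (by nlinarith)
    · rw [Set.indicator_of_notMem (by simpa using h)]
      exact zero_le
  | succ t ih =>
    have := isProbabilityMeasure_waitLaw hκ hη t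
    have := hη t
    rcases lt_or_ge u 0 with hu | hu
    · have := isProbabilityMeasure_waitLaw hκ hη (t + 1)
      refine prob_le_one.trans ?_
      rw [← ENNReal.ofReal_one]
      refine ENNReal.ofReal_le_ofReal ?_
      have h1 : 1 ≤ Real.exp (-θ * u) := Real.one_le_exp (by nlinarith)
      exact one_le_mul_of_one_le_of_one_le (one_le_pow₀ hc) h1
    · have hset : {y : ℝ | u < max 0 y} = Set.Ioi u := by
        ext y
        simp [not_lt.2 hu]
      have hE : Measurable fun d : ℝ => ENNReal.ofReal (Real.exp (-θ * d)) := by fun_prop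
      have hstep : waitLaw κ η (t + 1) {y | u < max 0 y}
          ≤ ENNReal.ofReal ((κ / (κ - θ)) ^ (t % k) * Real.exp (-θ * u))
            * (ENNReal.ofReal (κ / (κ - θ))
              * ∫⁻ d, ENNReal.ofReal (Real.exp (-θ * d)) ∂η t) := by
        rw [hset, waitLaw, Measure.map_apply (by fun_prop) measurableSet_Ioi,
          Measure.prod_apply_symm (measurableSet_Ioi.preimage (by fun_prop))]
        calc ∫⁻ p, waitLaw κ η t ((fun x => (x, p)) ⁻¹'
              ((fun p : ℝ × ℝ × ℝ => max 0 p.1 + p.2.1 - p.2.2) ⁻¹' Set.Ioi u))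
              ∂(expMeasure κ).prod (η t)
            ≤ ∫⁻ p, ENNReal.ofReal ((κ / (κ - θ)) ^ (t % k) * Real.exp (-θ * u))
              * (ENNReal.ofReal (Real.exp (θ * p.1)) * ENNReal.ofReal (Real.exp (-θ * p.2)))
              ∂(expMeasure κ).prod (η t) := by
              refine lintegral_mono fun p => ?_
              have e : (fun x => (x, p)) ⁻¹' ((fun p : ℝ × ℝ × ℝ =>
                  max 0 p.1 + p.2.1 - p.2.2) ⁻¹' Set.Ioi u) = {y | u - p.1 + p.2 < max 0 y} := by
                ext y
                simp only [Set.mem_preimage, Set.mem_Ioi, Set.mem_ofPred_eq]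
                constructor <;> intro h <;> linarith
              rw [e, ← ENNReal.ofReal_mul (Real.exp_pos _).le, ← ENNReal.ofReal_mul (by positivity),
                mul_assoc, ← Real.exp_add, ← Real.exp_add]
              refine (ih _).trans (le_of_eq ?_)
              congr 3
              ring
          _ = _ := by
              rw [lintegral_const_mul _ (by fun_prop), lintegral_prod _ (by fun_prop)]
              simp_rw [lintegral_const_mul _ hE]
              rw [lintegral_mul_const _ (by fun_prop), lintegral_exp_expMeasure hκ hθκ]
      refine hstep.trans ?_
      have hdvd : k ∣ t + 1 ↔ k ∣ t % k + 1 := by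
        conv_lhs => rw [← Nat.div_add_mod t k, add_assoc]
        exact Nat.dvd_add_right (dvd_mul_right k _)
      by_cases hdiv : k ∣ t + 1
      · have h1 : (t + 1) % k = 0 := Nat.mod_eq_zero_of_dvd hdiv
        have h2 : t % k + 1 = k :=
          le_antisymm (Nat.mod_lt t hk) (Nat.le_of_dvd (Nat.succ_pos _) (hdvd.1 hdiv))
        have e : ENNReal.ofReal ((κ / (κ - θ)) ^ (t % k) * Real.exp (-θ * u))
            * (ENNReal.ofReal (κ / (κ - θ)) * ∫⁻ d, ENNReal.ofReal (Real.exp (-θ * d)) ∂η t)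
            = ENNReal.ofReal (Real.exp (-θ * u)) * (ENNReal.ofReal ((κ / (κ - θ)) ^ k)
              * ∫⁻ d, ENNReal.ofReal (Real.exp (-θ * d)) ∂η t) := by
          conv_rhs => rw [← h2, pow_succ, ENNReal.ofReal_mul (by positivity)]
          rw [ENNReal.ofReal_mul (by positivity)]
          ring
        rw [e, h1, pow_zero, one_mul]
        exact (mul_le_mul_right (h_gap t hdiv) _).trans (by rw [mul_one])
      · have hlt : t % k + 1 < k := lt_of_le_of_ne (Nat.mod_lt t hk) fun h =>
          hdiv (hdvd.2 (dvd_of_eq h.symm))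
        have h1k : 1 % k = 1 := Nat.mod_eq_of_lt (by omega)
        have h2 : (t + 1) % k = t % k + 1 := by
          rw [Nat.add_mod_of_add_mod_lt (by rwa [h1k]), h1k]
        rw [h_within t hdiv, lintegral_dirac' _ hE, h2, pow_succ]
        simp only [mul_zero, Real.exp_zero, ENNReal.ofReal_one, mul_one]
        rw [← ENNReal.ofReal_mul (by positivity)]
        exact le_of_eq (by ring_nf)

/-! ### Adding the service time of a task -/

lemma setLIntegral_Iic_expMeasure {μ θ τ B : ℝ} (hμ : 0 < μ) (hθμ : θ ≠ μ) (hτ : 0 ≤ τ)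
    (hB : 0 ≤ B) :
    ∫⁻ s in Set.Iic τ, ENNReal.ofReal (B * Real.exp (-θ * (τ - s))) ∂expMeasure μ
      = ENNReal.ofReal (B * (μ / (μ - θ) * (Real.exp (-θ * τ) - Real.exp (-μ * τ)))) := by
  have hsub : μ - θ ≠ 0 := sub_ne_zero.2 hθμ.symm
  have hcont : Continuous fun s => μ * Real.exp (-(μ * s)) * (B * Real.exp (-θ * (τ - s))) := by
    fun_prop
  rw [← lintegral_indicator measurableSet_Iic, lintegral_expMeasure _ (Measurable.indicator
    (by fun_prop) measurableSet_Iic)]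
  have e : ∀ x, exponentialPDF μ x
      * (Set.Iic τ).indicator (fun s => ENNReal.ofReal (B * Real.exp (-θ * (τ - s)))) x
      = (Set.Icc 0 τ).indicator (fun s => ENNReal.ofReal
        (μ * Real.exp (-(μ * s)) * (B * Real.exp (-θ * (τ - s))))) x := by
    intro x
    rw [exponentialPDF_eq]
    by_cases h1 : 0 ≤ x <;> by_cases h2 : x ≤ τ
    · rw [if_pos h1, Set.indicator_of_mem (Set.mem_Iic.2 h2),
        Set.indicator_of_mem (Set.mem_Icc.2 ⟨h1, h2⟩), ← ENNReal.ofReal_mul (by positivity)]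
    · simp [h2]
    · simp [h1]
    · simp [h1]
  simp_rw [e]
  rw [lintegral_indicator measurableSet_Icc, ← ofReal_integral_eq_lintegral_ofReal
    (hcont.integrableOn_Icc) (Filter.Eventually.of_forall fun s => by positivity),
    integral_Icc_eq_integral_Ioc, ← intervalIntegral.integral_of_le hτ]
  congr 1
  have hderiv : ∀ s ∈ Set.uIcc 0 τ, HasDerivAt (fun s => -(B * (μ / (μ - θ)))
      * (Real.exp (-(μ * s)) * Real.exp (-θ * (τ - s))))
      (μ * Real.exp (-(μ * s)) * (B * Real.exp (-θ * (τ - s)))) s := by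
    intro s _
    have h1 : HasDerivAt (fun s => Real.exp (-(μ * s))) (Real.exp (-(μ * s)) * -(μ * 1)) s :=
      (((hasDerivAt_id s).const_mul μ).neg).exp
    have h2 : HasDerivAt (fun s => Real.exp (-θ * (τ - s)))
        (Real.exp (-θ * (τ - s)) * (-θ * (0 - 1))) s :=
      (((hasDerivAt_const s τ).sub (hasDerivAt_id s)).const_mul (-θ)).exp
    refine ((h1.mul h2).const_mul (-(B * (μ / (μ - θ))))).congr_deriv ?_
    field_simp
    ring
  rw [intervalIntegral.integral_eq_sub_of_hasDerivAt hderiv (hcont.intervalIntegrable _ _)]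
  simp only [sub_self, mul_zero, sub_zero, neg_zero, Real.exp_zero, one_mul, mul_one, neg_mul]
  ring

/-- Convolution of a tail bound with an exponential service time. -/
lemma prob_add_gt_le {Ω : Type*} [MeasurableSpace Ω] {P : Measure Ω} [IsProbabilityMeasure P]
    {μ θ τ B : ℝ} (hμ : 0 < μ) (hθμ : θ ≠ μ) (hτ : 0 ≤ τ) (hB : 0 ≤ B) {X S : Ω → ℝ}
    (hX : Measurable X) (hS : Measurable S) (hS_law : P.map S = expMeasure μ)
    (h_indep : IndepFun X S P) {ν : Measure ℝ} [IsProbabilityMeasure ν] (hν : ∀ᵐ x ∂ν, 0 ≤ x)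
    (htail : ∀ u, 0 ≤ u → P {ω | u < X ω}
      ≤ ν (Set.Ioi u) + ENNReal.ofReal (B * Real.exp (-θ * u))) :
    P {ω | τ < X ω + S ω} ≤ ENNReal.ofReal (Real.exp (-μ * τ))
        * ∫⁻ x, ENNReal.ofReal (Real.exp (μ * x)) ∂ν
      + ENNReal.ofReal (B * (μ / (μ - θ) * (Real.exp (-θ * τ) - Real.exp (-μ * τ)))) := by
  have := isProbabilityMeasure_expMeasure hμ
  have : IsProbabilityMeasure (P.map X) := Measure.isProbabilityMeasure_map hX.aemeasurable
  have hset : MeasurableSet {p : ℝ × ℝ | τ < p.1 + p.2} :=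
    measurableSet_lt measurable_const (by fun_prop)
  have hXtail : ∀ u, P.map X (Set.Ioi u) = P {ω | u < X ω} := fun u => by
    rw [Measure.map_apply hX measurableSet_Ioi]
    rfl
  have hpre : ∀ s : ℝ, (fun x : ℝ => (x, s)) ⁻¹' {p : ℝ × ℝ | τ < p.1 + p.2} = Set.Ioi (τ - s) :=
    fun s => by
      ext x
      simp [sub_lt_iff_lt_add]
  have hpre' : ∀ x : ℝ, Prod.mk x ⁻¹' {p : ℝ × ℝ | τ < p.1 + p.2} = Set.Ioi (τ - x) :=
    fun x => by
      ext s
      simp [sub_lt_iff_lt_add']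
  have h1 : P {ω | τ < X ω + S ω} = ∫⁻ s, P {ω | τ - s < X ω} ∂expMeasure μ := by
    calc P {ω | τ < X ω + S ω} = P.map (fun ω => (X ω, S ω)) {p | τ < p.1 + p.2} := by
          rw [Measure.map_apply (hX.prodMk hS) hset]
          rfl
      _ = ((P.map X).prod (expMeasure μ)) {p | τ < p.1 + p.2} := by
          rw [(indepFun_iff_map_prod_eq_prod_map_map hX.aemeasurable hS.aemeasurable).1 h_indep,
            hS_law]
      _ = _ := by
          rw [Measure.prod_apply_symm hset]
          simp_rw [hpre, hXtail]
  have h2 : ∀ s, P {ω | τ - s < X ω} ≤ ν (Set.Ioi (τ - s))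
      + (Set.Iic τ).indicator (fun s => ENNReal.ofReal (B * Real.exp (-θ * (τ - s)))) s := by
    intro s
    rcases le_or_gt s τ with hs | hs
    · rw [Set.indicator_of_mem (Set.mem_Iic.2 hs)]
      exact htail _ (by linarith)
    · have : ν (Set.Ioi (τ - s)) = 1 := by
        rw [← mem_ae_iff_prob_eq_one measurableSet_Ioi]
        filter_upwards [hν] with x hx
        exact lt_of_lt_of_le (by linarith) hx
      rw [this]
      exact prob_le_one.trans le_self_add
  have h3 : ∫⁻ s, ν (Set.Ioi (τ - s)) ∂expMeasure μ
      ≤ ENNReal.ofReal (Real.exp (-μ * τ)) * ∫⁻ x, ENNReal.ofReal (Real.exp (μ * x)) ∂ν := by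
    calc ∫⁻ s, ν (Set.Ioi (τ - s)) ∂expMeasure μ
        = (ν.prod (expMeasure μ)) {p | τ < p.1 + p.2} := by
          rw [Measure.prod_apply_symm hset]
          simp_rw [hpre]
      _ = ∫⁻ x, expMeasure μ (Set.Ioi (τ - x)) ∂ν := by
          rw [Measure.prod_apply hset]
          simp_rw [hpre']
      _ ≤ ∫⁻ x, ENNReal.ofReal (Real.exp (-μ * τ)) * ENNReal.ofReal (Real.exp (μ * x)) ∂ν := by
          refine lintegral_mono fun x => ?_
          rw [expMeasure_Ioi hμ, ← ENNReal.ofReal_mul (Real.exp_pos _).le, ← Real.exp_add]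
          refine ENNReal.ofReal_le_ofReal (Real.exp_le_exp.2 ?_)
          nlinarith [le_max_left (τ - x) 0]
      _ = _ := lintegral_const_mul _ (by fun_prop)
  calc P {ω | τ < X ω + S ω} = ∫⁻ s, P {ω | τ - s < X ω} ∂expMeasure μ := h1
    _ ≤ ∫⁻ s, (ν (Set.Ioi (τ - s)) + (Set.Iic τ).indicator
          (fun s => ENNReal.ofReal (B * Real.exp (-θ * (τ - s)))) s) ∂expMeasure μ :=
        lintegral_mono h2
    _ = ∫⁻ s, ν (Set.Ioi (τ - s)) ∂expMeasure μ + ENNReal.ofReal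
          (B * (μ / (μ - θ) * (Real.exp (-θ * τ) - Real.exp (-μ * τ)))) := by
        rw [lintegral_add_right _ (Measurable.indicator (by fun_prop) measurableSet_Iic),
          lintegral_indicator measurableSet_Iic, setLIntegral_Iic_expMeasure hμ hθμ hτ hB]
    _ ≤ _ := add_le_add_left h3 _

end ForkJoin

namespace ForkJoin

open scoped ENNReal

/-! ### Independence -/

variable {Ω : Type*} [MeasurableSpace Ω] {P : Measure Ω}

/-- Independence within two pairs and between them gives independence of the pairs formed
crosswise. -/
lemma indepFun_prodMk_prodMk [IsProbabilityMeasure P] {α₁ α₂ β₁ β₂ : Type*} [MeasurableSpace α₁]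
    [MeasurableSpace α₂] [MeasurableSpace β₁] [MeasurableSpace β₂] {X₁ : Ω → α₁} {X₂ : Ω → α₂}
    {Y₁ : Ω → β₁} {Y₂ : Ω → β₂} (hX₁ : Measurable X₁) (hX₂ : Measurable X₂) (hY₁ : Measurable Y₁)
    (hY₂ : Measurable Y₂) (hX : IndepFun X₁ X₂ P) (hY : IndepFun Y₁ Y₂ P)
    (hXY : IndepFun (fun ω => (X₁ ω, X₂ ω)) (fun ω => (Y₁ ω, Y₂ ω)) P) :
    IndepFun (fun ω => (X₁ ω, Y₁ ω)) (fun ω => (X₂ ω, Y₂ ω)) P := by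
  have h₁ : IndepFun X₁ Y₁ P := hXY.comp measurable_fst measurable_fst
  have h₂ : IndepFun X₂ Y₂ P := hXY.comp measurable_snd measurable_snd
  have := Measure.isProbabilityMeasure_map (μ := P) hX₁.aemeasurable
  have := Measure.isProbabilityMeasure_map (μ := P) hX₂.aemeasurable
  have := Measure.isProbabilityMeasure_map (μ := P) hY₁.aemeasurable
  have := Measure.isProbabilityMeasure_map (μ := P) hY₂.aemeasurable
  rw [indepFun_iff_map_prod_eq_prod_map_map hX₁.aemeasurable hX₂.aemeasurable] at hX
  rw [indepFun_iff_map_prod_eq_prod_map_map hY₁.aemeasurable hY₂.aemeasurable] at hY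
  rw [indepFun_iff_map_prod_eq_prod_map_map (hX₁.prodMk hX₂).aemeasurable
    (hY₁.prodMk hY₂).aemeasurable, hX, hY] at hXY
  rw [indepFun_iff_map_prod_eq_prod_map_map hX₁.aemeasurable hY₁.aemeasurable] at h₁
  rw [indepFun_iff_map_prod_eq_prod_map_map hX₂.aemeasurable hY₂.aemeasurable] at h₂
  rw [indepFun_iff_measure_inter_preimage_eq_mul]
  intro S T hS hT
  have hST : MeasurableSet {p : (α₁ × α₂) × (β₁ × β₂) | (p.1.1, p.2.1) ∈ S ∧ (p.1.2, p.2.2) ∈ T} :=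
    (hS.preimage (by fun_prop : Measurable fun p : (α₁ × α₂) × (β₁ × β₂) => (p.1.1, p.2.1))).inter
      (hT.preimage (by fun_prop : Measurable fun p : (α₁ × α₂) × (β₁ × β₂) => (p.1.2, p.2.2)))
  calc P ((fun ω => (X₁ ω, Y₁ ω)) ⁻¹' S ∩ (fun ω => (X₂ ω, Y₂ ω)) ⁻¹' T)
      = P.map (fun ω => ((X₁ ω, X₂ ω), (Y₁ ω, Y₂ ω)))
          {p | (p.1.1, p.2.1) ∈ S ∧ (p.1.2, p.2.2) ∈ T} := by
        rw [Measure.map_apply ((hX₁.prodMk hX₂).prodMk (hY₁.prodMk hY₂)) hST]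
        rfl
    _ = ∫⁻ x, (P.map Y₁) (Prod.mk x.1 ⁻¹' S) * (P.map Y₂) (Prod.mk x.2 ⁻¹' T)
          ∂(P.map X₁).prod (P.map X₂) := by
        rw [hXY, Measure.prod_apply hST]
        refine lintegral_congr fun x => ?_
        rw [← Measure.prod_prod]
        rfl
    _ = (P.map (fun ω => (X₁ ω, Y₁ ω))) S * (P.map (fun ω => (X₂ ω, Y₂ ω))) T := by
        rw [lintegral_prod_mul (measurable_measure_prodMk_left hS).aemeasurable
          (measurable_measure_prodMk_left hT).aemeasurable, h₁, h₂, Measure.prod_apply hS,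
          Measure.prod_apply hT]
    _ = _ := by
        rw [Measure.map_apply (hX₁.prodMk hY₁) hS, Measure.map_apply (hX₂.prodMk hY₂) hT]

/-- The sequence `x` with the terms from index `t` on replaced by zero. -/
def truncate (t : ℕ) (x : ℕ → ℝ) (s : ℕ) : ℝ := if s < t then x s else 0

lemma measurable_truncate (t : ℕ) : Measurable (truncate t) := by
  refine measurable_pi_lambda _ fun s => ?_
  unfold truncate
  split_ifs
  · exact measurable_pi_apply s
  · exact measurable_const

lemma residual_truncate {k : ℕ} [NeZero k] (δ q : ℕ → ℝ) (t : ℕ) :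
    (residual (truncate t δ) (truncate t q) t : Fin k → ℝ) = residual δ q t :=
  residual_congr (fun _ hs => if_pos hs) (fun _ hs => if_pos hs)

lemma indepFun_truncate {X : ℕ → Ω → ℝ} (hX : ∀ t, Measurable (X t)) (h : iIndepFun X P) (t : ℕ) :
    IndepFun (fun ω => truncate t fun s => X s ω) (X t) P := by
  have h1 := h.indepFun_finset (Finset.range t) {t} (by simp) hX
  have hφ : Measurable fun (v : Finset.range t → ℝ) (s : ℕ) =>
      if hs : s ∈ Finset.range t then v ⟨s, hs⟩ else 0 := by
    refine measurable_pi_lambda _ fun s => ?_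
    split_ifs
    · exact measurable_pi_apply _
    · exact measurable_const
  have hψ : Measurable fun v : ({t} : Finset ℕ) → ℝ => v ⟨t, Finset.mem_singleton_self t⟩ :=
    measurable_pi_apply _
  convert h1.comp hφ hψ using 1
  · funext ω s
    simp [truncate]
  · rfl

/-- The waiting times of the single queue are dominated by the single-server recursion as soon as
every interarrival time of the tasks is independent of its predecessors and the interarrival times
are independent of the service times. -/
lemma prob_delay_gt_le [IsProbabilityMeasure P] {k : ℕ} [NeZero k] {μ : ℝ} (hμ : 0 < μ)
    {δ q : ℕ → Ω → ℝ} (hδ : ∀ t, Measurable (δ t)) (hq : ∀ t, Measurable (q t))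
    (hq_law : ∀ t, P.map (q t) = expMeasure μ)
    (hδ_indep : ∀ t, IndepFun (fun ω => truncate t fun s => δ s ω) (δ t) P)
    (hq_indep : iIndepFun q P)
    (hδq : IndepFun (fun ω s => δ s ω) (fun ω s => q s ω) P) (t : ℕ) (u : ℝ) :
    P {ω | u < delay (residual (fun s => δ s ω) (fun s => q s ω) t : Fin k → ℝ)}
      ≤ waitLaw (k * μ) (fun t => P.map (δ t)) t {y | u < max 0 y} := by
  have hres : ∀ t, Measurable fun ω => (residual (fun s => δ s ω) (fun s => q s ω) t :
      Fin k → ℝ) := fun t =>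
    (measurable_residual t).comp ((measurable_pi_lambda _ hδ).prodMk (measurable_pi_lambda _ hq))
  have hδ' : ∀ t, Measurable fun ω => truncate t fun s => δ s ω := fun t =>
    (measurable_truncate t).comp (measurable_pi_lambda _ hδ)
  have hq' : ∀ t, Measurable fun ω => truncate t fun s => q s ω := fun t =>
    (measurable_truncate t).comp (measurable_pi_lambda _ hq)
  have h1 : ∀ t, IndepFun (fun ω => (residual (fun s => δ s ω) (fun s => q s ω) t :
      Fin k → ℝ)) (fun ω => (q t ω, δ t ω)) P := by
    intro t
    have hφ : Measurable fun x : ℕ → ℝ => (truncate t x, x t) :=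
      (measurable_truncate t).prodMk (measurable_pi_apply t)
    have h := (indepFun_prodMk_prodMk (hδ' t) (hδ t) (hq' t) (hq t) (hδ_indep t)
      (indepFun_truncate hq hq_indep t) (hδq.comp hφ hφ)).comp (measurable_residual (k := k) t)
      measurable_swap
    convert h using 1
    · funext ω
      exact (residual_truncate _ _ t).symm
    · rfl
  have h2 : ∀ t, IndepFun (q t) (δ t) P := fun t =>
    (hδq.comp (measurable_pi_apply t) (measurable_pi_apply t)).symm
  have hIoi : Measurable ((Set.Ioi u).indicator (1 : ℝ → ℝ≥0∞)) :=
    measurable_one.indicator measurableSet_Ioi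
  have hmono : Monotone ((Set.Ioi u).indicator (1 : ℝ → ℝ≥0∞)) := by
    intro x y hxy
    by_cases hx : u < x
    · rw [Set.indicator_of_mem (Set.mem_Ioi.2 hx), Set.indicator_of_mem
        (Set.mem_Ioi.2 (hx.trans_le hxy))]
      rfl
    · rw [Set.indicator_of_notMem (by simpa using hx)]
      exact zero_le
  have h := lintegral_delay_le hμ hδ hq hq_law h1 h2 t hIoi hmono
  have e1 : MeasurableSet {ω | u < delay (residual (fun s => δ s ω) (fun s => q s ω) t :
      Fin k → ℝ)} := measurableSet_lt measurable_const (measurable_delay.comp (hres t))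
  have e2 : MeasurableSet {y : ℝ | u < max 0 y} := measurableSet_lt measurable_const (by fun_prop)
  calc _ = ∫⁻ ω, (Set.Ioi u).indicator (1 : ℝ → ℝ≥0∞)
        (delay (residual (fun s => δ s ω) (fun s => q s ω) t : Fin k → ℝ)) ∂P :=
        (lintegral_indicator_one e1).symm
    _ ≤ _ := h
    _ = _ := lintegral_indicator_one e2

/-! ### Waiting times under random arrivals -/

variable {k : ℕ} [NeZero k] {μ : ℝ} {A : ℕ → Ω → ℝ} {Q : ℕ → Fin k → Ω → ℝ}

lemma injective_div_ofNat (k : ℕ) [NeZero k] :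
    Function.Injective fun t : ℕ => (t / k, Fin.ofNat k t) := by
  intro s t h
  rw [Prod.mk.injEq, Fin.ext_iff] at h
  rw [← Nat.div_add_mod s k, ← Nat.div_add_mod t k, h.1]
  exact congrArg _ h.2

lemma iIndepFun_taskService (hQ_indep : iIndepFun (fun t : ℕ × Fin k => Q t.1 t.2) P) :
    iIndepFun (fun (t : ℕ) ω => taskService (fun n i => Q n i ω) t) P :=
  hQ_indep.precomp (injective_div_ofNat k)

lemma measurable_taskService (hQ : ∀ n i, Measurable (Q n i)) (t : ℕ) :
    Measurable fun ω => taskService (fun n i => Q n i ω) t :=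
  hQ _ _

lemma waitingTime_taskService (a : ℕ → ℝ) (q : ℕ → Fin k → ℝ) (n : ℕ) (i : Fin k) :
    waitingTime a (fun m (j : Fin k) => taskService q (m * k + j)) n i = waitingTime a q n i := by
  simp only [taskService_mul_add]

lemma indepFun_taskService
    (hAQ : IndepFun (fun ω (n : ℕ) => A n ω) (fun ω (t : ℕ × Fin k) => Q t.1 t.2 ω) P) :
    IndepFun (fun ω (n : ℕ) => A n ω) (fun ω t => taskService (fun n i => Q n i ω) t) P := by
  have hψ : Measurable fun (q : ℕ × Fin k → ℝ) (t : ℕ) => q (t / k, Fin.ofNat k t) :=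
    measurable_pi_lambda _ fun _ => measurable_pi_apply _
  exact hAQ.comp measurable_id hψ

lemma measurable_waitingTime_comp (hA : ∀ n, Measurable (A n)) (hQ : ∀ n i, Measurable (Q n i))
    (n : ℕ) (i : Fin k) :
    Measurable fun ω => waitingTime (fun m => A m ω) (fun m i => Q m i ω) n i := by
  have h := (measurable_waitingTime n i).comp ((measurable_pi_lambda _ hA).prodMk
    (measurable_pi_lambda _ (measurable_taskService hQ)))
  convert h using 1
  funext ω
  exact (waitingTime_taskService _ _ n i).symm

/-- The waiting time of a task depends only on the arrivals and on the service times of the tasks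
ahead of it. -/
lemma indepFun_waitingTime [IsProbabilityMeasure P] (hA : ∀ n, Measurable (A n))
    (hQ : ∀ n i, Measurable (Q n i)) (hQ_indep : iIndepFun (fun t : ℕ × Fin k => Q t.1 t.2) P)
    (hAQ : IndepFun (fun ω (n : ℕ) => A n ω) (fun ω (t : ℕ × Fin k) => Q t.1 t.2 ω) P)
    (n : ℕ) (i : Fin k) :
    IndepFun (fun ω => waitingTime (fun m => A m ω) (fun m i => Q m i ω) n i) (Q n i) P := by
  set t := n * k + (i : ℕ) with ht
  have hq := measurable_taskService hQ
  have hA' : Measurable fun ω (n : ℕ) => A n ω := measurable_pi_lambda _ hA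
  have hq' : Measurable fun ω => truncate t fun s => taskService (fun n i => Q n i ω) s :=
    (measurable_truncate t).comp (measurable_pi_lambda _ hq)
  have hφ : Measurable fun x : ℕ → ℝ => (x, ()) := by fun_prop
  have hψ : Measurable fun x : ℕ → ℝ => (truncate t x, x t) :=
    (measurable_truncate t).prodMk (measurable_pi_apply t)
  have h := (indepFun_prodMk_prodMk hA' (measurable_const (a := ())) hq' (hq t)
    (indepFun_const_right _ ()) (indepFun_truncate hq (iIndepFun_taskService hQ_indep) t)
    ((indepFun_taskService hAQ).comp hφ hψ)).comp (measurable_waitingTime n i) measurable_snd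
  convert h using 1
  · funext ω
    simp only [Function.comp_apply]
    rw [waitingTime_eq_delay, waitingTime_eq_delay, idleAt_congr]
    intro s hs
    have : taskService (fun m (j : Fin k) => truncate t (fun s =>
        taskService (fun n i => Q n i ω) s) (m * k + j)) s
        = truncate t (fun s => taskService (fun n i => Q n i ω) s) s := by
      rw [taskService, Fin.val_ofNat, mul_comm, Nat.div_add_mod]
    rw [this, truncate, if_pos hs]
  · funext ω
    exact (taskService_mul_add (fun n i => Q n i ω) n i).symm

/-- Conditioning on the arrivals, which are independent of the service times. -/
lemma prob_waitingTime_gt_eq_lintegral [IsProbabilityMeasure P] (hA : ∀ n, Measurable (A n))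
    (hQ : ∀ n i, Measurable (Q n i))
    (hAQ : IndepFun (fun ω (n : ℕ) => A n ω) (fun ω (t : ℕ × Fin k) => Q t.1 t.2 ω) P)
    (n : ℕ) (i : Fin k) (u : ℝ) :
    P {ω | u < waitingTime (fun m => A m ω) (fun m i => Q m i ω) n i}
      = ∫⁻ ω, P {ω' | u < waitingTime (fun m => A m ω) (fun m i => Q m i ω') n i} ∂P := by
  have hA' : Measurable fun ω (n : ℕ) => A n ω := measurable_pi_lambda _ hA
  have hq' : Measurable fun ω t => taskService (fun n i => Q n i ω) t :=
    measurable_pi_lambda _ (measurable_taskService hQ)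
  have := Measure.isProbabilityMeasure_map (μ := P) hA'.aemeasurable
  have := Measure.isProbabilityMeasure_map (μ := P) hq'.aemeasurable
  have hS : MeasurableSet {p : (ℕ → ℝ) × (ℕ → ℝ) |
      u < waitingTime p.1 (fun n (i : Fin k) => p.2 (n * k + i)) n i} :=
    measurableSet_lt measurable_const (measurable_waitingTime n i)
  have hjoint := (indepFun_iff_map_prod_eq_prod_map_map hA'.aemeasurable hq'.aemeasurable).1
    (indepFun_taskService hAQ)
  calc P {ω | u < waitingTime (fun m => A m ω) (fun m i => Q m i ω) n i}
      = P.map (fun ω => (fun n => A n ω, fun t => taskService (fun n i => Q n i ω) t))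
        {p | u < waitingTime p.1 (fun n (i : Fin k) => p.2 (n * k + i)) n i} := by
        rw [Measure.map_apply (hA'.prodMk hq') hS]
        simp only [Set.preimage_ofPred_eq, waitingTime_taskService]
    _ = _ := by
        rw [hjoint, Measure.prod_apply hS, lintegral_map (measurable_measure_prodMk_left hS) hA']
        refine lintegral_congr fun ω => ?_
        rw [Measure.map_apply hq' (hS.preimage measurable_prodMk_left)]
        simp only [Set.preimage_ofPred_eq, waitingTime_taskService]

lemma prob_waitingTime_gt_le_sum [IsProbabilityMeasure P] (hμ : 0 < μ)
    (hQ : ∀ n i, Measurable (Q n i)) (hQ_indep : iIndepFun (fun t : ℕ × Fin k => Q t.1 t.2) P)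
    (hQ_law : ∀ n i, HasLaw (Q n i) (expMeasure μ) P) {a : ℕ → ℝ} (ha : 0 ≤ a 0) (n : ℕ)
    (i : Fin k) (u : ℝ) :
    P {ω | u < waitingTime a (fun m i => Q m i ω) n i}
      ≤ ∑ m ∈ Finset.range (n + 1),
          erlang (k * μ) (n * k + i - m * k) (Set.Ioi (u + (a n - a m))) := by
  have hk : (0 : ℝ) < k := by exact_mod_cast Nat.pos_of_ne_zero (NeZero.ne k)
  have h1 := prob_delay_gt_le (P := P) (k := k) hμ (δ := fun t _ => taskGap k a t)
    (q := fun t ω => taskService (fun n i => Q n i ω) t) (fun t => measurable_const)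
    (measurable_taskService hQ) (fun t => (hQ_law _ _).map_eq)
    (fun t => indepFun_const_right _ _) (iIndepFun_taskService hQ_indep)
    (indepFun_const_left _ _) (n * k + i) u
  have h2 := lintegral_waitLaw_dirac_le (mul_pos hk hμ) a (k := k) (n * k + i)
    (g := (Set.Ioi u).indicator 1) (measurable_one.indicator measurableSet_Ioi)
  rw [mul_add_val_div] at h2
  calc P {ω | u < waitingTime a (fun m i => Q m i ω) n i}
      ≤ P {ω | u < delay (residual (taskGap k a) (taskService fun m i => Q m i ω) (n * k + i) :
          Fin k → ℝ)} :=
        measure_mono fun ω hω => lt_of_lt_of_le hω (waitingTime_le_delay _ ha n i)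
    _ ≤ _ := h1
    _ = ∫⁻ y, (Set.Ioi u).indicator (1 : ℝ → ℝ≥0∞) (max 0 y)
          ∂waitLaw (k * μ) (fun t => Measure.dirac (taskGap k a t)) (n * k + i) := by
        have e2 : MeasurableSet {y : ℝ | u < max 0 y} :=
          measurableSet_lt measurable_const (by fun_prop)
        simp only [Measure.map_const, measure_univ, one_smul]
        exact (lintegral_indicator_one e2).symm
    _ ≤ _ := h2
    _ = _ := by
        refine Finset.sum_congr rfl fun m _ => ?_
        rw [← lintegral_indicator_one measurableSet_Ioi]
        refine lintegral_congr fun x => ?_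
        simp only [Set.indicator, Set.mem_Ioi]
        congr 1
        rw [eq_iff_iff]
        constructor <;> intro h <;> linarith

end ForkJoin

namespace ForkJoin

open scoped ENNReal

/-! ### Tails of the waiting times -/

lemma taskGap_of_dvd {k : ℕ} (a : ℕ → ℝ) {t : ℕ} (h : k ∣ t + 1) :
    taskGap k a t = a (t / k + 1) - a (t / k) := by
  rw [taskGap, Nat.succ_div_of_dvd h]

lemma taskGap_of_not_dvd {k : ℕ} (a : ℕ → ℝ) {t : ℕ} (h : ¬ k ∣ t + 1) : taskGap k a t = 0 := by
  rw [taskGap, Nat.succ_div_of_not_dvd h, sub_self]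

lemma indepFun_truncate_taskGap {Ω : Type*} [MeasurableSpace Ω] {P : Measure Ω}
    [IsProbabilityMeasure P] {k : ℕ} {A : ℕ → Ω → ℝ} (hA : ∀ n, Measurable (A n))
    (h_indep : iIndepFun (fun (n : ℕ) ω => A (n + 1) ω - A n ω) P) (t : ℕ) :
    IndepFun (fun ω => truncate t fun s => taskGap k (fun m => A m ω) s)
      (fun ω => taskGap k (fun m => A m ω) t) P := by
  by_cases hdvd : k ∣ t + 1
  · have hgap : ∀ n, Measurable fun ω => A (n + 1) ω - A n ω := fun n => (hA (n + 1)).sub (hA n)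
    have h := indepFun_truncate hgap h_indep (t / k)
    have hφ : Measurable fun (x : ℕ → ℝ) (s : ℕ) =>
        if s < t ∧ k ∣ s + 1 then x (s / k) else 0 := by
      refine measurable_pi_lambda _ fun s => ?_
      split_ifs
      · exact measurable_pi_apply _
      · exact measurable_const
    convert h.comp hφ measurable_id using 1
    · funext ω s
      simp only [truncate, Function.comp_apply]
      by_cases hs : s < t
      · by_cases hs' : k ∣ s + 1
        · have hlt : s / k < t / k := by
            have := Nat.div_lt_div_of_lt_of_dvd hdvd (Nat.succ_lt_succ hs)
            rw [Nat.succ_div_of_dvd hs', Nat.succ_div_of_dvd hdvd] at this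
            omega
          rw [if_pos hs, if_pos ⟨hs, hs'⟩, if_pos hlt, taskGap_of_dvd _ hs']
        · rw [if_pos hs, if_neg fun h => hs' h.2]
          exact taskGap_of_not_dvd _ hs'
      · rw [if_neg hs, if_neg fun h => hs h.1]
    · funext ω
      exact taskGap_of_dvd _ hdvd
  · simp only [taskGap_of_not_dvd _ hdvd]
    exact indepFun_const_right _ _

variable {Ω : Type*} [MeasurableSpace Ω] {P : Measure Ω} {k : ℕ} [NeZero k]
  {μ θ : ℝ} {A : ℕ → Ω → ℝ} {Q : ℕ → Fin k → Ω → ℝ}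

lemma lintegral_exp_arrival [IsProbabilityMeasure P] (hA : ∀ n, Measurable (A n))
    (hA_mono : ∀ᵐ ω ∂P, Monotone fun n => A n ω) (hθ : 0 < θ) {m n : ℕ} (hmn : m ≤ n) :
    ∫⁻ ω, ENNReal.ofReal (Real.exp (-θ * (A n ω - A m ω))) ∂P
      = ENNReal.ofReal (∫ ω, Real.exp (-θ * (A n ω - A m ω)) ∂P) := by
  refine (ofReal_integral_eq_lintegral_ofReal ?_ (Filter.Eventually.of_forall fun ω =>
    (Real.exp_pos _).le)).symm
  refine Integrable.of_bound (by fun_prop) 1 ?_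
  filter_upwards [hA_mono] with ω hω
  rw [Real.norm_eq_abs, Real.abs_exp, Real.exp_le_one_iff]
  nlinarith [hω hmn]

/-- The job `n` itself contributes an Erlang variable with `i` stages; every earlier job `m` that
may start the busy period contributes an exponential term, and these terms form a geometric
series. -/
lemma prob_waitingTime_gt_le_of_lowerConstrained [IsProbabilityMeasure P] (hμ : 0 < μ)
    (hA : ∀ n, Measurable (A n))
    (hQ : ∀ n i, Measurable (Q n i))
    (hA_order : ∀ᵐ ω ∂P, 0 ≤ A 0 ω ∧ Monotone fun n => A n ω)
    (hQ_indep : iIndepFun (fun t : ℕ × Fin k => Q t.1 t.2) P)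
    (hQ_law : ∀ n i, HasLaw (Q n i) (expMeasure μ) P)
    (hAQ : IndepFun (fun ω (n : ℕ) => A n ω) (fun ω (t : ℕ × Fin k) => Q t.1 t.2 ω) P)
    (hθ : 0 < θ) (hθk : θ < k * μ) {σ ρ : ℝ}
    (h_arr : ∀ m n : ℕ, m ≤ n → ∫ ω, Real.exp (-θ * (A n ω - A m ω)) ∂P
      ≤ Real.exp (-θ * (ρ * ((n : ℝ) - (m : ℝ)) - σ)))
    (h_stable : (k * μ / (k * μ - θ)) ^ k * Real.exp (-θ * ρ) < 1) (n : ℕ) (i : Fin k) (u : ℝ) :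
    P {ω | u < waitingTime (fun m => A m ω) (fun m i => Q m i ω) n i}
      ≤ erlang (k * μ) i (Set.Ioi u) + ENNReal.ofReal
        ((Real.exp (θ * σ) / (1 - (k * μ / (k * μ - θ)) ^ k * Real.exp (-θ * ρ)) - 1)
          * (k * μ / (k * μ - θ)) ^ (i : ℕ) * Real.exp (-θ * u)) := by
  have hk : (0 : ℝ) < k := by exact_mod_cast Nat.pos_of_ne_zero (NeZero.ne k)
  have hκ : 0 < k * μ := mul_pos hk hμ
  have hA_mono : ∀ᵐ ω ∂P, Monotone fun n => A n ω := hA_order.mono fun ω h => h.2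
  set c := k * μ / (k * μ - θ) with hc_def
  have hc : 0 < c := div_pos hκ (by linarith)
  set r := c ^ k * Real.exp (-θ * ρ) with hr_def
  have hr : 0 < r := by positivity
  set E := Real.exp (θ * σ) with hE_def
  -- the constraint for `m = n`
  have hE1 : 1 ≤ E := by
    have := h_arr n n le_rfl
    simpa [hE_def] using this
  have hterm : ∀ m ∈ Finset.range n,
      ∫⁻ ω, erlang (k * μ) (n * k + i - m * k) (Set.Ioi (u + (A n ω - A m ω))) ∂P
        ≤ ENNReal.ofReal (c ^ (i : ℕ) * Real.exp (-θ * u) * E * r ^ (n - m)) := by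
    intro m hm
    have hmn : m ≤ n := (Finset.mem_range.1 hm).le
    obtain ⟨j, rfl⟩ := Nat.exists_eq_add_of_le hmn
    have hexp : (m + j) * k + (i : ℕ) - m * k = j * k + i := by
      rw [add_mul]
      omega
    rw [hexp, Nat.add_sub_cancel_left]
    calc ∫⁻ ω, erlang (k * μ) (j * k + i) (Set.Ioi (u + (A (m + j) ω - A m ω))) ∂P
        ≤ ∫⁻ ω, ENNReal.ofReal (c ^ (j * k + (i : ℕ)) * Real.exp (-θ * u))
            * ENNReal.ofReal (Real.exp (-θ * (A (m + j) ω - A m ω))) ∂P := by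
          refine lintegral_mono fun ω => (erlang_Ioi_le hκ hθ hθk _ _).trans (le_of_eq ?_)
          rw [← ENNReal.ofReal_mul (by positivity), mul_add, Real.exp_add, mul_assoc]
      _ = ENNReal.ofReal (c ^ (j * k + (i : ℕ)) * Real.exp (-θ * u)
            * ∫ ω, Real.exp (-θ * (A (m + j) ω - A m ω)) ∂P) := by
          rw [lintegral_const_mul _ (by fun_prop), lintegral_exp_arrival hA hA_mono hθ hmn,
            ← ENNReal.ofReal_mul (by positivity)]
      _ ≤ ENNReal.ofReal (c ^ (j * k + (i : ℕ)) * Real.exp (-θ * u)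
            * Real.exp (-θ * (ρ * (((m + j : ℕ) : ℝ) - (m : ℝ)) - σ))) := by
          refine ENNReal.ofReal_le_ofReal ?_
          gcongr
          exact h_arr m (m + j) hmn
      _ = _ := by
          congr 1
          have : Real.exp (-θ * (ρ * (((m + j : ℕ) : ℝ) - (m : ℝ)) - σ))
              = Real.exp (-θ * ρ) ^ j * E := by
            rw [hE_def, ← Real.exp_nat_mul, ← Real.exp_add]
            congr 1
            push_cast
            ring
          rw [this, hr_def, mul_pow, ← pow_mul, pow_add, mul_comm j k]
          ring
  have hgeom : ∑ m ∈ Finset.range n, r ^ (n - m) ≤ r / (1 - r) := by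
    have e : ∑ m ∈ Finset.range n, r ^ (n - m) = ∑ m ∈ Finset.range n, r ^ (m + 1) := by
      rw [← Finset.sum_range_reflect]
      refine Finset.sum_congr rfl fun m hm => ?_
      have := Finset.mem_range.1 hm
      congr 1
      omega
    have h1 : ∑ m ∈ Finset.range n, r ^ m ≤ (1 - r)⁻¹ := by
      have := (summable_geometric_of_lt_one hr.le h_stable).sum_le_tsum (Finset.range n)
        fun _ _ => by positivity
      rwa [tsum_geometric_of_lt_one hr.le h_stable] at this
    rw [e]
    simp_rw [pow_succ']
    rw [← Finset.mul_sum, div_eq_mul_inv]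
    gcongr
  have hmeas : ∀ m, Measurable fun ω =>
      erlang (k * μ) (n * k + i - m * k) (Set.Ioi (u + (A n ω - A m ω))) := by
    intro m
    have hanti : Antitone fun v => erlang (k * μ) (n * k + i - m * k) (Set.Ioi v) := fun v w hvw =>
      measure_mono (Set.Ioi_subset_Ioi hvw)
    exact hanti.measurable.comp (by fun_prop)
  calc P {ω | u < waitingTime (fun m => A m ω) (fun m i => Q m i ω) n i}
      = ∫⁻ ω, P {ω' | u < waitingTime (fun m => A m ω) (fun m i => Q m i ω') n i} ∂P :=
        prob_waitingTime_gt_eq_lintegral hA hQ hAQ n i u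
    _ ≤ ∫⁻ ω, ∑ m ∈ Finset.range (n + 1),
          erlang (k * μ) (n * k + i - m * k) (Set.Ioi (u + (A n ω - A m ω))) ∂P := by
        refine lintegral_mono_ae ?_
        filter_upwards [hA_order] with ω hω
        exact prob_waitingTime_gt_le_sum hμ hQ hQ_indep hQ_law hω.1 n i u
    _ = erlang (k * μ) i (Set.Ioi u) + ∑ m ∈ Finset.range n,
          ∫⁻ ω, erlang (k * μ) (n * k + i - m * k) (Set.Ioi (u + (A n ω - A m ω))) ∂P := by
        rw [lintegral_finsetSum _ fun m _ => hmeas m, Finset.sum_range_succ, add_comm]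
        simp
    _ ≤ erlang (k * μ) i (Set.Ioi u) + ∑ m ∈ Finset.range n,
          ENNReal.ofReal (c ^ (i : ℕ) * Real.exp (-θ * u) * E * r ^ (n - m)) :=
        add_le_add_right (Finset.sum_le_sum hterm) _
    _ ≤ _ := by
        rw [← ENNReal.ofReal_sum_of_nonneg fun m _ => by positivity, ← Finset.mul_sum]
        refine add_le_add_right (ENNReal.ofReal_le_ofReal ?_) _
        have h1r : 0 < 1 - r := by linarith
        have e : E / (1 - r) - 1 = E * (r / (1 - r)) + (E - 1) := by
          field_simp
          ring
        calc c ^ (i : ℕ) * Real.exp (-θ * u) * E * ∑ m ∈ Finset.range n, r ^ (n - m)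
            ≤ c ^ (i : ℕ) * Real.exp (-θ * u) * E * (r / (1 - r)) := by gcongr
          _ = E * (r / (1 - r)) * c ^ (i : ℕ) * Real.exp (-θ * u) := by ring
          _ ≤ _ := by
              rw [e]
              gcongr
              linarith

lemma prob_waitingTime_gt_le_of_iid [IsProbabilityMeasure P] (hμ : 0 < μ)
    (hA : ∀ n, Measurable (A n))
    (hQ : ∀ n i, Measurable (Q n i))
    (hA_order : ∀ᵐ ω ∂P, 0 ≤ A 0 ω ∧ Monotone fun n => A n ω)
    (hQ_indep : iIndepFun (fun t : ℕ × Fin k => Q t.1 t.2) P)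
    (hQ_law : ∀ n i, HasLaw (Q n i) (expMeasure μ) P)
    (hAQ : IndepFun (fun ω (n : ℕ) => A n ω) (fun ω (t : ℕ × Fin k) => Q t.1 t.2 ω) P)
    (hθ : 0 < θ) (hθk : θ < k * μ)
    (h_indep : iIndepFun (fun (n : ℕ) ω => A (n + 1) ω - A n ω) P)
    (h_ident : ∀ n : ℕ,
      IdentDistrib (fun ω => A (n + 1) ω - A n ω) (fun ω => A 1 ω - A 0 ω) P P)
    (h_stable : (k * μ / (k * μ - θ)) ^ k * ∫ ω, Real.exp (-θ * (A 1 ω - A 0 ω)) ∂P ≤ 1)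
    (n : ℕ) (i : Fin k) (u : ℝ) :
    P {ω | u < waitingTime (fun m => A m ω) (fun m i => Q m i ω) n i}
      ≤ ENNReal.ofReal ((k * μ / (k * μ - θ)) ^ (i : ℕ) * Real.exp (-θ * u)) := by
  have hkpos : 0 < k := Nat.pos_of_ne_zero (NeZero.ne k)
  have hk : (0 : ℝ) < k := by exact_mod_cast hkpos
  have hκ : 0 < k * μ := mul_pos hk hμ
  have hc : 0 < k * μ / (k * μ - θ) := div_pos hκ (by linarith)
  have hA_mono : ∀ᵐ ω ∂P, Monotone fun n => A n ω := hA_order.mono fun ω h => h.2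
  have hδ : ∀ t, Measurable fun ω => taskGap k (fun m => A m ω) t := fun t =>
    (hA _).sub (hA _)
  have hψ : Measurable fun (a : ℕ → ℝ) t => taskGap k a t :=
    measurable_pi_lambda _ fun t => (measurable_pi_apply _).sub (measurable_pi_apply _)
  have h1 := prob_delay_gt_le (P := P) (k := k) hμ (δ := fun t ω => taskGap k (fun m => A m ω) t)
    (q := fun t ω => taskService (fun n i => Q n i ω) t) hδ
    (measurable_taskService hQ) (fun t => (hQ_law _ _).map_eq)
    (indepFun_truncate_taskGap hA h_indep) (iIndepFun_taskService hQ_indep)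
    ((indepFun_taskService hAQ).comp hψ measurable_id) (n * k + i) u
  have h2 := waitLaw_gt_le hκ hθ hθk hkpos
    (η := fun t => P.map fun ω => taskGap k (fun m => A m ω) t)
    (fun t => Measure.isProbabilityMeasure_map (hδ t).aemeasurable)
    (fun t ht => by simp only [taskGap_of_not_dvd _ ht, Measure.map_const, measure_univ, one_smul])
    (fun t ht => by
      have e : ∫⁻ d, ENNReal.ofReal (Real.exp (-θ * d))
            ∂P.map (fun ω => taskGap k (fun m => A m ω) t)
          = ENNReal.ofReal (∫ ω, Real.exp (-θ * (A 1 ω - A 0 ω)) ∂P) := by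
        have hE : Measurable fun d : ℝ => ENNReal.ofReal (Real.exp (-θ * d)) := by fun_prop
        have hgap : Measurable fun ω => A 1 ω - A 0 ω := (hA 1).sub (hA 0)
        rw [show (fun ω => taskGap k (fun m => A m ω) t)
          = fun ω => A (t / k + 1) ω - A (t / k) ω from funext fun ω => taskGap_of_dvd _ ht,
          (h_ident (t / k)).map_eq, lintegral_map hE hgap,
          lintegral_exp_arrival hA hA_mono hθ (Nat.zero_le 1)]
      rw [e, ← ENNReal.ofReal_mul (by positivity)]
      exact ENNReal.ofReal_le_one.2 h_stable)
    (n * k + i) u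
  rw [Nat.mul_add_mod', Nat.mod_eq_of_lt i.2] at h2
  refine le_trans (measure_mono_ae ?_) (h1.trans h2)
  filter_upwards [hA_order] with ω hω h
  exact lt_of_lt_of_le h (waitingTime_le_delay _ hω.1 n i)

/-! ### Sojourn times -/

lemma prob_sojournTime_gt_le_sum (n : ℕ) (τ : ℝ) :
    P {ω | τ < sojournTime (fun m => A m ω) (fun m i => Q m i ω) n}
      ≤ ∑ i : Fin k, P {ω | τ < waitingTime (fun m => A m ω) (fun m i => Q m i ω) n i
          + Q n i ω} := by
  refine le_trans (measure_mono fun ω hω => ?_) (measure_iUnion_fintype_le _ _)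
  exact Set.mem_iUnion.2 ((sojournTime_gt_iff _ _ n τ).1 hω)

/-- The union bound over the tasks, when the waiting time of task `i` has the tail of an Erlang
variable with `j i` stages up to an exponential term. -/
lemma prob_sojournTime_gt_le [IsProbabilityMeasure P] (hμ : 0 < μ) (hA : ∀ n, Measurable (A n))
    (hQ : ∀ n i, Measurable (Q n i))
    (hQ_indep : iIndepFun (fun t : ℕ × Fin k => Q t.1 t.2) P)
    (hQ_law : ∀ n i, HasLaw (Q n i) (expMeasure μ) P)
    (hAQ : IndepFun (fun ω (n : ℕ) => A n ω) (fun ω (t : ℕ × Fin k) => Q t.1 t.2 ω) P)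
    (hθμ : θ ≠ μ) {τ : ℝ} (hτ : 0 ≤ τ) (n : ℕ) (j : Fin k → ℕ) (hj : ∀ i, j i ≤ i)
    {B : Fin k → ℝ} (hB : ∀ i, 0 ≤ B i)
    (htail : ∀ i u, 0 ≤ u → P {ω | u < waitingTime (fun m => A m ω) (fun m i => Q m i ω) n i}
      ≤ erlang (k * μ) (j i) (Set.Ioi u) + ENNReal.ofReal (B i * Real.exp (-θ * u))) :
    P.real {ω | τ < sojournTime (fun m => A m ω) (fun m i => Q m i ω) n}
      ≤ (∑ i, (k * μ / (k * μ - μ)) ^ j i) * Real.exp (-μ * τ)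
        + (∑ i, B i) * (μ / (μ - θ) * (Real.exp (-θ * τ) - Real.exp (-μ * τ))) := by
  have hkpos : 0 < k := Nat.pos_of_ne_zero (NeZero.ne k)
  have hκ : 0 < k * μ := mul_pos (by exact_mod_cast hkpos) hμ
  have hh := hypoexp_nonneg hμ hθμ hτ
  set h := μ / (μ - θ) * (Real.exp (-θ * τ) - Real.exp (-μ * τ)) with h_def
  have hd : 0 ≤ k * μ / (k * μ - μ) := by
    refine div_nonneg hκ.le ?_
    have : (1 : ℝ) ≤ k := by exact_mod_cast hkpos
    nlinarith
  -- for `k = 1` only the Erlang variable without stages occurs, and the quotient is not used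
  have hmoment : ∀ i, ∫⁻ x, ENNReal.ofReal (Real.exp (μ * x)) ∂erlang (k * μ) (j i)
      = ENNReal.ofReal ((k * μ / (k * μ - μ)) ^ j i) := by
    intro i
    rcases Nat.eq_zero_or_pos (j i) with h0 | h0
    · rw [h0, erlang, lintegral_dirac' _ (by fun_prop)]
      simp
    · have hk1 : 1 < k := by
        have := hj i
        omega
      have : (1 : ℝ) < k := by exact_mod_cast hk1
      exact lintegral_exp_erlang hκ (by nlinarith) _
  have hterm : ∀ i, P {ω | τ < waitingTime (fun m => A m ω) (fun m i => Q m i ω) n i + Q n i ω}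
      ≤ ENNReal.ofReal (Real.exp (-μ * τ) * (k * μ / (k * μ - μ)) ^ j i + B i * h) := by
    intro i
    have := isProbabilityMeasure_erlang hκ (j i)
    have h1 := prob_add_gt_le hμ hθμ hτ (hB i) (measurable_waitingTime_comp hA hQ n i) (hQ n i)
      (hQ_law n i).map_eq (indepFun_waitingTime hA hQ hQ_indep hAQ n i)
      (ae_nonneg_erlang hκ (j i)) (htail i)
    rw [hmoment, ← ENNReal.ofReal_mul (Real.exp_pos _).le] at h1
    rwa [ENNReal.ofReal_add (by positivity) (mul_nonneg (hB i) hh)]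
  have hnonneg : ∀ i, 0 ≤ Real.exp (-μ * τ) * (k * μ / (k * μ - μ)) ^ j i + B i * h := fun i =>
    add_nonneg (by positivity) (mul_nonneg (hB i) hh)
  have hsum : P {ω | τ < sojournTime (fun m => A m ω) (fun m i => Q m i ω) n}
      ≤ ENNReal.ofReal (∑ i, (Real.exp (-μ * τ) * (k * μ / (k * μ - μ)) ^ j i + B i * h)) := by
    rw [ENNReal.ofReal_sum_of_nonneg fun i _ => hnonneg i]
    exact (prob_sojournTime_gt_le_sum n τ).trans (Finset.sum_le_sum fun i _ => hterm i)
  refine (ENNReal.toReal_le_of_le_ofReal (Finset.sum_nonneg fun i _ => hnonneg i) hsum).trans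
    (le_of_eq ?_)
  rw [Finset.sum_add_distrib, ← Finset.mul_sum, ← Finset.sum_mul, mul_comm (Real.exp (-μ * τ))]

/-! ### Parameters -/

lemma exp_nat_mul_rhoZ {k : ℕ} {μ θ : ℝ} (hθ : 0 < θ) (hk : 0 < k * μ) (hθk : θ < k * μ) (j : ℕ) :
    Real.exp (θ * j * rhoZ k μ θ) = (k * μ / (k * μ - θ)) ^ j := by
  have e : θ * j * rhoZ k μ θ = j * Real.log (k * μ / (k * μ - θ)) := by
    rw [rhoZ]
    field_simp
  rw [e, Real.exp_nat_mul, Real.exp_log (div_pos hk (by linarith))]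

lemma beta_eq_sum {k : ℕ} {μ θ : ℝ} (hθ : 0 < θ) (hk : 0 < k * μ) (hθk : θ < k * μ) :
    beta k μ θ = ∑ i : Fin k, (k * μ / (k * μ - θ)) ^ (i : ℕ) := by
  have h1 := exp_nat_mul_rhoZ hθ hk hθk 1
  rw [Nat.cast_one, mul_one, pow_one] at h1
  have hne : k * μ / (k * μ - θ) ≠ 1 := by
    rw [Ne, div_eq_one_iff_eq (by linarith)]
    linarith
  rw [beta, exp_nat_mul_rhoZ hθ hk hθk, h1, ← geom_sum_eq hne,
    Fin.sum_univ_eq_sum_range fun i => (k * μ / (k * μ - θ)) ^ i]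

lemma alpha_eq {k : ℕ} {μ θ : ℝ} (hθ : 0 < θ) (hk : 0 < k * μ) (hθk : θ < k * μ) (σ ρ : ℝ) :
    alpha k μ θ σ ρ
      = Real.exp (θ * σ) / (1 - (k * μ / (k * μ - θ)) ^ k * Real.exp (-θ * ρ)) := by
  rw [alpha, ← exp_nat_mul_rhoZ hθ hk hθk, ← Real.exp_add]
  congr 3
  ring

end ForkJoin

/-! ### The tail bounds of the fork-join system -/

theorem theorem4 {Ω : Type*} [MeasurableSpace Ω] (P : Measure Ω) [IsProbabilityMeasure P]
    (k : ℕ) [NeZero k] (μ : ℝ) (hμ : 0 < μ)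
    -- arrival times of the jobs and service times of the tasks
    (A : ℕ → Ω → ℝ) (Q : ℕ → Fin k → Ω → ℝ)
    (hA : ∀ n, Measurable (A n)) (hQ : ∀ n i, Measurable (Q n i))
    (hA_order : ∀ᵐ ω ∂P, 0 ≤ A 0 ω ∧ Monotone fun n => A n ω)
    -- iid exponential service times with parameter `μ`, independent of the arrivals
    (hQ_indep : iIndepFun (fun t : ℕ × Fin k => Q t.1 t.2) P)
    (hQ_law : ∀ n i, HasLaw (Q n i) (expMeasure μ) P)
    (hAQ : IndepFun (fun ω (n : ℕ) => A n ω) (fun ω (t : ℕ × Fin k) => Q t.1 t.2 ω) P)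
    (θ : ℝ) (hθ : 0 < θ) (hθk : θ < k * μ) (hθμ : θ ≠ μ) :
    -- general arrivals
    (∀ σA ρA : ℝ → ℝ, ForkJoin.IsLowerConstrained P A σA ρA →
      k * ForkJoin.rhoZ k μ θ < ρA (-θ) →
      ∀ n : ℕ, ∀ τ : ℝ, 0 ≤ τ →
        P.real {ω | τ < ForkJoin.sojournTime (fun m => A m ω) (fun m i => Q m i ω) n}
            ≤ ForkJoin.alpha k μ θ (σA (-θ)) (ρA (-θ)) * ForkJoin.beta k μ θ * (μ / (μ - θ))
                * (Real.exp (-θ * τ) - Real.exp (-μ * τ)) + Real.exp (-μ * τ) ∧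
        ∀ i : Fin k,
          P.real {ω | τ < ForkJoin.waitingTime (fun m => A m ω) (fun m i => Q m i ω) n i}
            ≤ ForkJoin.alpha k μ θ (σA (-θ)) (ρA (-θ))
                * Real.exp (θ * (i : ℝ) * ForkJoin.rhoZ k μ θ) * Real.exp (-θ * τ)) ∧
    -- arrivals with iid inter-arrival times
    (iIndepFun (fun (n : ℕ) ω => A (n + 1) ω - A n ω) P →
      (∀ n : ℕ, IdentDistrib (fun ω => A (n + 1) ω - A n ω) (fun ω => A 1 ω - A 0 ω) P P) →
      k * ForkJoin.rhoZ k μ θ ≤ ForkJoin.giArrivalRho P A θ →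
      ∀ n : ℕ, ∀ τ : ℝ, 0 ≤ τ →
        P.real {ω | τ < ForkJoin.sojournTime (fun m => A m ω) (fun m i => Q m i ω) n}
            ≤ ForkJoin.beta k μ θ * (μ / (μ - θ))
                * (Real.exp (-θ * τ) - Real.exp (-μ * τ)) + k * Real.exp (-μ * τ) ∧
        ∀ i : Fin k,
          P.real {ω | τ < ForkJoin.waitingTime (fun m => A m ω) (fun m i => Q m i ω) n i}
            ≤ Real.exp (θ * (i : ℝ) * ForkJoin.rhoZ k μ θ) * Real.exp (-θ * τ)) := by
  have hkpos : 0 < k := Nat.pos_of_ne_zero (NeZero.ne k)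
  have hκ : 0 < k * μ := hθ.trans hθk
  have hc : 0 < k * μ / (k * μ - θ) := div_pos hκ (by linarith)
  have hrho := ForkJoin.exp_nat_mul_rhoZ hθ hκ hθk
  refine ⟨fun σA ρA hA_low h_stable n τ hτ => ?_, fun h_indep h_ident h_stable n τ hτ => ?_⟩
  · have hr : (k * μ / (k * μ - θ)) ^ k * Real.exp (-θ * ρA (-θ)) < 1 := by
      rw [← hrho, ← Real.exp_add, Real.exp_lt_one_iff]
      nlinarith
    have htail := ForkJoin.prob_waitingTime_gt_le_of_lowerConstrained hμ hA hQ hA_order hQ_indep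
      hQ_law hAQ hθ hθk (fun m n hmn => hA_low m n hmn θ hθ) hr n
    have hα : 1 ≤ ForkJoin.alpha k μ θ (σA (-θ)) (ρA (-θ)) := by
      -- the constraint on the arrivals for `m = n` forces `σA (-θ) ≥ 0`
      have hσ : 1 ≤ Real.exp (θ * σA (-θ)) := by
        have := hA_low 0 0 le_rfl θ hθ
        simpa using this
      rw [ForkJoin.alpha_eq hθ hκ hθk, le_div_iff₀ (by linarith)]
      have : 0 < (k * μ / (k * μ - θ)) ^ k * Real.exp (-θ * ρA (-θ)) := by positivity
      linarith
    rw [← ForkJoin.alpha_eq hθ hκ hθk] at htail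
    set α := ForkJoin.alpha k μ θ (σA (-θ)) (ρA (-θ))
    refine ⟨?_, fun i => ?_⟩
    · have h1 := ForkJoin.prob_sojournTime_gt_le hμ hA hQ hQ_indep hQ_law hAQ hθμ hτ n
        (fun i => (i : ℕ)) (fun i => le_rfl)
        (B := fun i => (α - 1) * (k * μ / (k * μ - θ)) ^ (i : ℕ))
        (fun i => mul_nonneg (by linarith) (by positivity)) (fun i u _ => htail i u)
      have h2 := ForkJoin.min_sum_mul_exp_le hkpos hμ hθ hθk hθμ hτ
      have h3 := ForkJoin.hypoexp_nonneg hμ hθμ hτ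
      rw [← Finset.mul_sum, ← ForkJoin.beta_eq_sum hθ hκ hθk,
        Fin.sum_univ_eq_sum_range fun i => (k * μ / (k * μ - μ)) ^ i] at h1
      rw [← Fin.sum_univ_eq_sum_range (fun i => (k * μ / (k * μ - θ)) ^ i),
        ← ForkJoin.beta_eq_sum hθ hκ hθk] at h2
      have hβ : 0 ≤ ForkJoin.beta k μ θ := by
        rw [ForkJoin.beta_eq_sum hθ hκ hθk]
        positivity
      have h4 : P.real {ω | τ < ForkJoin.sojournTime (fun m => A m ω) (fun m i => Q m i ω) n} ≤ 1 :=
        measureReal_le_one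
      have h5 : 0 ≤ (α - 1) * ForkJoin.beta k μ θ
          * (μ / (μ - θ) * (Real.exp (-θ * τ) - Real.exp (-μ * τ))) :=
        mul_nonneg (mul_nonneg (by linarith) hβ) h3
      -- the probability is at most one, so that the coefficient of `e^{-μτ}` can be reduced to one
      have h6 := le_min (h4.trans (le_add_of_nonneg_right h5)) h1
      rw [← min_add] at h6
      linarith
    · refine ENNReal.toReal_le_of_le_ofReal (by positivity) ((htail i τ).trans ?_)
      rw [hrho]
      refine (add_le_add_left (ForkJoin.erlang_Ioi_le hκ hθ hθk i τ) _).trans (le_of_eq ?_)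
      have hα' : 0 ≤ α - 1 := by linarith
      rw [← ENNReal.ofReal_add (by positivity) (by positivity)]
      congr 1
      ring
  · -- the stability condition, freed of the logarithms
    have hI : (k * μ / (k * μ - θ)) ^ k * ∫ ω, Real.exp (-θ * (A 1 ω - A 0 ω)) ∂P ≤ 1 := by
      have hint : Integrable (fun ω => Real.exp (-θ * (A 1 ω - A 0 ω))) P := by
        refine Integrable.of_bound (by fun_prop) 1 ?_
        filter_upwards [hA_order] with ω hω
        rw [Real.norm_eq_abs, Real.abs_exp, Real.exp_le_one_iff]
        nlinarith [hω.2 zero_le_one]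
      have hpos : 0 < ∫ ω, Real.exp (-θ * (A 1 ω - A 0 ω)) ∂P := integral_exp_pos hint
      have hlog : θ * k * ForkJoin.rhoZ k μ θ
          ≤ -Real.log (∫ ω, Real.exp (-θ * (A 1 ω - A 0 ω)) ∂P) := by
        have h := mul_le_mul_of_nonneg_left h_stable hθ.le
        rw [ForkJoin.giArrivalRho] at h
        have e : θ * (-(1 / θ) * Real.log (∫ ω, Real.exp (-θ * (A 1 ω - A 0 ω)) ∂P))
            = -Real.log (∫ ω, Real.exp (-θ * (A 1 ω - A 0 ω)) ∂P) := by
          field_simp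
        linarith
      rw [← hrho]
      have h := Real.exp_le_exp.2 hlog
      rw [Real.exp_neg, Real.exp_log hpos] at h
      exact (le_div_iff₀ hpos).1 (by rwa [one_div])
    have htail := ForkJoin.prob_waitingTime_gt_le_of_iid hμ hA hQ hA_order hQ_indep hQ_law hAQ hθ
      hθk h_indep h_ident hI n
    refine ⟨?_, fun i => ?_⟩
    · have h := ForkJoin.prob_sojournTime_gt_le hμ hA hQ hQ_indep hQ_law hAQ hθμ hτ n
        (fun _ => 0) (fun _ => Nat.zero_le _) (B := fun i => (k * μ / (k * μ - θ)) ^ (i : ℕ))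
        (fun i => by positivity) (fun i u _ => le_add_left (htail i u))
      rw [← ForkJoin.beta_eq_sum hθ hκ hθk] at h
      simp only [pow_zero, Finset.sum_const, Finset.card_univ, Fintype.card_fin, nsmul_eq_mul,
        mul_one] at h
      linarith
    · rw [hrho]
      exact ENNReal.toReal_le_of_le_ofReal (by positivity) (htail i τ)
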